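/- **Setting.** Positions are the points $x=(p,q)\in\mathbb Z^2$ (column $p$, row $q$) of the hexagonal lattice in axial coordinates. Walls are indexed by $w\in\mathbb Z/6$, counter-clockwise, with unit vectors $\hat u_0=(0,1)$ (F), $\hat u_1=(-1,1)$ (FL), $\hat u_2=(-1,0)$ (RL), $\hat u_3=(0,-1)$ (R), $\hat u_4=(1,-1)$ (RR), $\hat u_5=(1,0)$ (FR); the walls $0,3$ are the fore-aft walls, $\{1,2\}$ is the left flank and $\{4,5\}$ the right flank; $x,y$ are adjacent if $y=x+\hat u_w$ for some $w$. The target shape $S\subset\mathbb Z^2$ is finite, contains the origin, and is hole-free: no simple cycle of adjacent positions of $S$, viewed as a closed polygon through the hexagon centres, has a position outside $S$ in its interior. Its perimeter $X_b$ is the set of $x\in S$ with at least one adjacent position outside $S$. Robots know $X_b$ only; they take as *target positions* those that lie in $X_b$ or are enclosed (ray casting) by a minimal, i.e. chordless simple, cycle contained in $X_b$. A *segment* is a maximal set of consecutive target positions in one column; its midpoint is rounded down. **Wall status.** Let $X(t)$ be the set of occupied positions at time $t$. The wall $w$ of a robot at $x$ is *null* if $x+\hat u_w$ is not a target position; otherwise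 it is *occupied* or *free* according to whether $x+\hat u_w\in X(t)$. Write $s_{i,w}$ for the status of wall $w$ of robot $i$. **Initialization (once, when robot $i$ at $x_i=(p_i,q_i)$ attaches).** For each flank (with $a=-1$ for left, $a=1$ for right) the robot determines a flag $\alpha_{\rm left},\alpha_{\rm right}$ as follows. 1. If no wall of the flank is free, the flag is false. 2. Otherwise, if some free wall of the flank has both neighbouring walls null, the flag is true. 3. Otherwise, let $Q$ be the segment of column $p_i+a$ that the flank faces, $q_m$ the row of its midpoint, and $Q_{p_i}$ the segment containing $x_i$. If $q_i=q_m$, the flag is true; if $q_i\ne q_m$ and $(p_i,q_m)\in Q_{p_i}$, it is false; otherwise it is true if and only if $q_i$ is, among the rows $r$ with $(p_i+a,r)\in Q$ and $(p_i,r)\in Q_{p_i}$, a nearest one to $q_m$. The growth direction is $g_i=0$ if both flags are true; else $g_i=1$ if $s_{i,1}$ or $s_{i,2}$ is occupied or $\alpha_{\rm right}$ is true; else $g_i=-1$ if $s_{i,4}$ or $s_{i,5}$ is occupied or $\alpha_{\rm left}$ is true; else $g_i=0$. The flags and $g_i$ stay fixed. **Signal activation (at each time step).** The nominal walls $W_i$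 are the free fore-aft walls if there are any. Otherwise they are the free flank walls $w$ such that at least one of the following holds: both neighbouring walls of $w$ are occupied; one neighbouring wall is a null fore-aft wall and the other is occupied; the flag of the flank of $w$ is true. The delayed walls $\tilde W_i$ are: if $g_i=-1$, wall $0$ if wall $5$ is occupied by a neighbour whose wall $0$ is free, and wall $3$ if wall $4$ is occupied by a neighbour whose wall $3$ is free; if $g_i=1$, the same with $1,2$ in place of $5,4$; if $g_i=0$, none. Robot $i$ signals on $W_i\setminus\tilde W_i$. **Executions.** $X(0)=\{(0,0)\}$, with the root robot initialized there. At each time step $t=0,1,2,\dots$, new robots attach at an arbitrary (possibly empty) finite set of unoccupied positions, each of which is faced by a wall that signals at time $t$; the new robots are initialized with the wall statuses after these attachments. The assembly graph $G(t)$ has the vertex set $X(t)$ and an edge between any two adjacent positions. **Theorem (Reachability).** For every such $S$, every execution and every time $t$ (in particular, every $t$ before completion of $S$), $G(t)$ maintains reachability: for every $y\in S\setminus X(t)$ adjacent to a position of $X(t)$, the vertex at $y$ in the assembly graph on $X(t)\cup\{y\}$ satisfies $1\le\deg\le 3$. -/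

import Mathlib

noncomputable section

namespace Huddle

/-! ### The hexagonal lattice -/

/-- Positions `(p, q)` of the hexagonal lattice in axial coordinates:
`p` is the column, `q` is the row. -/
abbrev Cell : Type := ℤ × ℤ

/-- Wall indices, counter-clockwise: `0 = F`, `1 = FL`, `2 = RL`, `3 = R`, `4 = RR`, `5 = FR`.
Addition and subtraction of indices are modulo `6`, so the two walls next to `w` are
`w - 1` and `w + 1`. -/
abbrev Wall : Type := Fin 6

/-- The unit vector pointing in the direction of wall `w`. -/
def unitVec : Wall → Cell :=
  ![(0, 1), (-1, 1), (-1, 0), (0, -1), (1, -1), (1, 0)]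

/-- The opposite wall has the opposite unit vector. -/
theorem unitVec_opposite (w : Wall) : unitVec (w + 3) = -unitVec w := by
  fin_cases w <;> rfl

/-- No unit vector vanishes. -/
theorem unitVec_ne_zero (w : Wall) : unitVec w ≠ 0 := by
  fin_cases w <;> simp [unitVec]

/-- The adjacency graph of the hexagonal lattice. -/
def hexGraph : SimpleGraph Cell where
  Adj x y := ∃ w : Wall, y = x + unitVec w
  symm := ⟨by
    rintro x y ⟨w, rfl⟩
    exact ⟨w + 3, by rw [unitVec_opposite]; abel⟩⟩
  loopless := ⟨by
    rintro x ⟨w, h⟩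
    exact unitVec_ne_zero w (by simpa using h)⟩

instance : DecidableRel hexGraph.Adj := fun x y =>
  inferInstanceAs (Decidable (∃ w : Wall, y = x + unitVec w))

/-- The assembly graph with occupied positions `X`: one vertex for each robot (identified with
its position), and an edge for each pair of attached robots. -/
def assemblyGraph (X : Finset Cell) : SimpleGraph {x // x ∈ X} :=
  hexGraph.comap Subtype.val

instance (X : Finset Cell) : DecidableRel (assemblyGraph X).Adj := fun x y =>
  inferInstanceAs (Decidable (hexGraph.Adj x.1 y.1))

/-! ### Reachability -/

/-- The unoccupied target positions that are adjacent to an occupied one. -/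
def openings (S X : Finset Cell) : Set Cell :=
  {y | y ∈ S ∧ y ∉ X ∧ ∃ x ∈ X, hexGraph.Adj y x}

/-- The degree that a new vertex at position `y` has in the assembly graph after it is added. -/
def degreeIfAdded (X : Finset Cell) (y : Cell) : ℕ :=
  (assemblyGraph (insert y X)).degree ⟨y, Finset.mem_insert_self y X⟩

/-- The assembly with occupied positions `X` maintains reachability with respect to the target
shape `S`. -/
def MaintainsReachability (S X : Finset Cell) : Prop :=
  ∀ y ∈ openings S X, 1 ≤ degreeIfAdded X y ∧ degreeIfAdded X y ≤ 3

/-! ### Cycles, enclosed positions, hole-free shapes -/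

/-- Twice the Cartesian ordinate of the centre of a hexagon (two neighbours in a column are
at distance `1`). The Cartesian abscissa is a fixed multiple of the column. -/
def height (x : Cell) : ℤ := 2 * x.2 + x.1

/-- The segment from the centre of `a` up to the centre of the adjacent cell `b` crosses the
horizontal ray that starts at the centre of `y` and points left; a crossing in the upper end
point `b` is not counted (the half-open rule of ray casting). If `a` and `b` lie in one column,
the crossing is in that column; otherwise `height b = height a + 1`, so that the crossing is
the point `a` itself. In both cases it is left of `y` exactly if `a.1 < y.1`. -/
def UpCrossing (y a b : Cell) : Prop :=
  height a ≤ height y ∧ height y < height b ∧ a.1 < y.1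

open Classical in
/-- The number of edges of a closed walk that cross the ray starting at `y`. -/
def crossingNumber {v : Cell} (c : hexGraph.Walk v v) (y : Cell) : ℕ :=
  c.darts.countP fun d => decide (UpCrossing y d.fst d.snd ∨ UpCrossing y d.snd d.fst)

/-- The position `y` lies in the interior of the closed polygon `c` (ray casting, even-odd
rule). -/
def Encloses {v : Cell} (c : hexGraph.Walk v v) (y : Cell) : Prop :=
  y ∉ c.support ∧ Odd (crossingNumber c y)

/-- A shape is hole-free if no simple cycle in it encloses a position outside the shape. -/
def HoleFree (S : Finset Cell) : Prop :=
  ∀ (v : Cell) (c : hexGraph.Walk v v), c.IsCycle → (∀ x ∈ c.support, x ∈ S) →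
    ∀ y, Encloses c y → y ∈ S

/-- The perimeter of `S`: the hexagons of `S` with at least one unattached side. -/
def perimeter (S : Finset Cell) : Finset Cell :=
  S.filter fun x => ∃ w : Wall, x + unitVec w ∉ S

/-- `c` is a minimal (that is, simple and chordless) cycle contained in `B`. -/
def IsMinimalCycle (B : Finset Cell) {v : Cell} (c : hexGraph.Walk v v) : Prop :=
  c.IsCycle ∧ (∀ x ∈ c.support, x ∈ B) ∧
    ∀ x ∈ c.support, ∀ y ∈ c.support, hexGraph.Adj x y → s(x, y) ∈ c.edges

/-- The positions that a robot takes for target positions, given only the perimeter `B`: those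
in `B` and those enclosed by a minimal cycle contained in `B`. -/
def targetOf (B : Finset Cell) : Set Cell :=
  {y | y ∈ B ∨ ∃ (v : Cell) (c : hexGraph.Walk v v), IsMinimalCycle B c ∧ Encloses c y}

/-! ### Walls -/

inductive WallStatus : Type
  | null
  | free
  | occupied
  deriving DecidableEq

/-- A wall status vector. -/
abbrev StatusVec : Type := Wall → WallStatus

open Classical in
/-- The wall status vector of a robot at `x`, where `B` is the perimeter and `X` the set of
occupied positions. Connection walls are those that face a position in `targetOf B`. -/
def status (B X : Finset Cell) (x : Cell) : StatusVec := fun w =>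
  if x + unitVec w ∉ targetOf B then WallStatus.null
  else if x + unitVec w ∈ X then WallStatus.occupied
  else WallStatus.free

inductive Flank : Type
  | left
  | right
  deriving DecidableEq

/-- The two walls of a flank. -/
def Flank.walls : Flank → Finset Wall
  | .left => {1, 2}
  | .right => {4, 5}

/-- The column direction of a flank. -/
def Flank.dir : Flank → ℤ
  | .left => -1
  | .right => 1

/-! ### Role determination -/

/-- Role determination from the robot's own wall status vector; `none` is "undefined". -/
def roleFromSelf (s : StatusVec) (F : Flank) : Option Bool :=
  if ∃ w ∈ F.walls, s w = .free then
    if ∃ w ∈ F.walls, s w = .free ∧ s (w - 1) = .null ∧ s (w + 1) = .null then some true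
    else none
  else some false

/-- The rows of the maximal contiguous segment of target positions in column `p` that contains
`(p, r)` (empty if `(p, r)` is not a target position). -/
def colSegment (B : Finset Cell) (p r : ℤ) : Set ℤ :=
  {q | ∀ k ∈ Set.uIcc q r, (p, k) ∈ targetOf B}

/-- The target column `p`: its contiguous segments, each given by its set of rows. -/
def targetColumn (B : Finset Cell) (p : ℤ) : Set (Set ℤ) :=
  {Q | ∃ r : ℤ, (p, r) ∈ targetOf B ∧ Q = colSegment B p r}

/-- The row of the midpoint of a segment, rounded down. -/
def midRow (Q : Set ℤ) : ℤ := (sInf Q + sSup Q) / 2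

/-- `r` is a row of the adjacent segment `Q` that also is a row of the robot's own segment
`Q₀`, and among these rows it is nearest to the midpoint of `Q`. -/
def IsNearestConnection (Q Q₀ : Set ℤ) (r : ℤ) : Prop :=
  r ∈ Q ∩ Q₀ ∧ ∀ k ∈ Q ∩ Q₀, |r - midRow Q| ≤ |k - midRow Q|

open Classical in
/-- Role determination from the target adjacent column: `Q` is the segment of the adjacent
target column that the robot at `x` faces with its flank `F`. -/
def roleFromColumn (B : Finset Cell) (x : Cell) (F : Flank) : Bool :=
  decide (∃ Q ∈ targetColumn B (x.1 + F.dir), (∃ w ∈ F.walls, (x + unitVec w).2 ∈ Q) ∧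
    if x.2 = midRow Q then True
    else if midRow Q ∈ colSegment B x.1 x.2 then False
    else IsNearestConnection Q (colSegment B x.1 x.2) x.2)

/-- Nucleation requirement of a robot at `x` with wall status vector `s` on flank `F`. -/
def nucleation (B : Finset Cell) (s : StatusVec) (x : Cell) (F : Flank) : Bool :=
  match roleFromSelf s F with
  | some b => b
  | none => roleFromColumn B x F

/-- Growth direction. -/
def growthDirection (αl αr : Bool) (s : StatusVec) : ℤ :=
  if αl = true ∧ αr = true then 0
  else if (s 1 = .occupied ∨ s 2 = .occupied) ∨ αr = true then 1
  else if (s 4 = .occupied ∨ s 5 = .occupied) ∨ αl = true then -1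
  else 0

/-- What a robot determines once and for all when it is initialized. -/
structure Memory : Type where
  /-- nucleation requirement on the left flank -/
  αLeft : Bool
  /-- nucleation requirement on the right flank -/
  αRight : Bool
  /-- growth direction -/
  g : ℤ

/-- The initialization phase of a robot at `x` when the set of occupied positions is `X`. -/
def initialMemory (B X : Finset Cell) (x : Cell) : Memory :=
  let s := status B X x
  let αl := nucleation B s x .left
  let αr := nucleation B s x .right
  ⟨αl, αr, growthDirection αl αr s⟩

/-! ### Signal activation -/

/-- The special flank signal condition: `w` is between two occupied walls, or between a null
fore-aft wall and an occupied wall. -/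
def SpecialCondition (s : StatusVec) (w : Wall) : Prop :=
  (s (w - 1) = .occupied ∧ s (w + 1) = .occupied) ∨
  ((w - 1 = 0 ∨ w - 1 = 3) ∧ s (w - 1) = .null ∧ s (w + 1) = .occupied) ∨
  ((w + 1 = 0 ∨ w + 1 = 3) ∧ s (w + 1) = .null ∧ s (w - 1) = .occupied)

/-- The nominal signaling walls. -/
def nominalWalls (s : StatusVec) (αl αr : Bool) : Set Wall :=
  {w | (¬ ∀ k, s k = .occupied) ∧ s w = .free ∧
    if s 0 = .free ∨ s 3 = .free then w = 0 ∨ w = 3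
    else w ∈ ({1, 2, 4, 5} : Set Wall) ∧
      (SpecialCondition s w ∨
        (αl = true ∧ w ∈ Flank.left.walls) ∨ (αr = true ∧ w ∈ Flank.right.walls))}

/-- The walls with delayed activation; `s` is the robot's own status vector and `nb w` the
status vector of its neighbour at wall `w` (used only where `s w` is occupied). -/
def delayedWalls (s : StatusVec) (nb : Wall → StatusVec) (g : ℤ) : Set Wall :=
  {w | (g = -1 ∧
      ((w = 0 ∧ s 5 = .occupied ∧ nb 5 0 = .free) ∨
       (w = 3 ∧ s 4 = .occupied ∧ nb 4 3 = .free))) ∨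
    (g = 1 ∧
      ((w = 0 ∧ s 1 = .occupied ∧ nb 1 0 = .free) ∨
       (w = 3 ∧ s 2 = .occupied ∧ nb 2 3 = .free)))}

/-- The walls on which a robot at `x` with memory `m` signals. -/
def activeWalls (B X : Finset Cell) (x : Cell) (m : Memory) : Set Wall :=
  nominalWalls (status B X x) m.αLeft m.αRight \
    delayedWalls (status B X x) (fun w => status B X (x + unitVec w)) m.g

/-! ### Executions -/

/-- The state of the assembly: the occupied positions, and the memory of the robot at each of
them (the values at unoccupied positions are irrelevant). -/
structure Config : Type where
  occ : Finset Cell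
  mem : Cell → Memory

/-- An in-assembly robot signals towards the position `y`. -/
def Signaled (B : Finset Cell) (c : Config) (y : Cell) : Prop :=
  ∃ x ∈ c.occ, ∃ w ∈ activeWalls B c.occ x (c.mem x), y = x + unitVec w

/-- One time step: passing-by robots attach at an arbitrary finite set `N` of unoccupied
positions towards which some in-assembly robot signals, and each of them runs its
initialization phase; the other robots keep their memory. -/
def Step (B : Finset Cell) (c c' : Config) : Prop :=
  ∃ N : Finset Cell,
    (∀ y ∈ N, y ∉ c.occ ∧ Signaled B c y) ∧
    c'.occ = c.occ ∪ N ∧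
    (∀ x ∈ c.occ, c'.mem x = c.mem x) ∧
    (∀ y ∈ N, c'.mem y = initialMemory B c'.occ y)

/-- An execution of Huddle with perimeter `B`: it starts with the root robot alone, at the
origin. -/
def IsExecution (B : Finset Cell) (run : ℕ → Config) : Prop :=
  (run 0).occ = {(0, 0)} ∧ (run 0).mem (0, 0) = initialMemory B {(0, 0)} (0, 0) ∧
    ∀ t, Step B (run t) (run (t + 1))

end Huddle

end

/-! Cut `S` into its maximal column segments. Because `S` is hole-free, the graph of adjacent
segments is a forest (`HoleFree.segGraph_isAcyclic`). Hence a segment joined to that of the root has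
at most one adjacent segment of smaller depth, its parent (`HoleFree.seg_eq_of_depth_lt`), and
adjacent positions in different columns belong to a parent and a child.

The flags let a parent start a given child from one position only (`IsNucleationSite.unique`,
`IsSeed.unique`), and the delay rule lets a segment grow only past parent positions that are already
occupied. `Invariant` records the outcome: the occupied part of each segment is an interval, and an
occupied position has all its adjacent parent positions occupied. What the signals permit is
`Attachable`; `Invariant.contiguous_union` and `Attachable.initialMemory_g` show that simultaneous
attachments preserve the invariant.

Now let `y` be an opening. Its walls `0` and `3` are not both occupied, since the occupied part of
its segment is an interval. An occupied neighbour in another column lies in the parent of `y`, as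
otherwise `y` would already be occupied; so only one flank has occupied walls. The degree is at most
`1 + 2`.

The planar topology is done modulo 2. Crossings with a ray form a cochain on edges, and a cochain
that vanishes on all cycles in a set is a coboundary there (`exists_potential_on`). Around an
interior position of `S` this fails on the perimeter (`crossing_not_coboundary`), so some perimeter
cycle encloses the position; this gives `targetOf_perimeter`. Around a missing position of a
hole-free shape it holds, and the potential separates the two sides of a gap
(`HoleFree.not_joined`). -/

noncomputable section

namespace Huddle

/-! ### Sums of cochains modulo 2 along walks -/

section WalkSum

variable {V : Type*} {G : SimpleGraph V} (f : V → V → ZMod 2)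

/-- The sum of the values of `f` on the darts of a walk. -/
def walkSum {u : V} : {v : V} → G.Walk u v → ZMod 2
  | _, .nil => 0
  | _, .cons (v := b) _ p => f u b + walkSum (u := b) p

@[simp]
theorem walkSum_nil (u : V) : walkSum f (.nil : G.Walk u u) = 0 := by
  simp [walkSum]

@[simp]
theorem walkSum_cons {u b v : V} (h : G.Adj u b) (p : G.Walk b v) :
    walkSum f (.cons h p) = f u b + walkSum f p := by
  simp [walkSum]

theorem walkSum_append {u v w : V} (p : G.Walk u v) (q : G.Walk v w) :
    walkSum f (p.append q) = walkSum f p + walkSum f q := by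
  induction p with
  | nil => simp
  | cons h p ih => simp [ih, add_assoc]

theorem walkSum_reverse (hf : ∀ a b, f a b = f b a) {u v : V} (p : G.Walk u v) :
    walkSum f p.reverse = walkSum f p := by
  induction p with
  | nil => simp
  | cons h p ih => simp [walkSum_append, ih, hf, add_comm]

theorem walkSum_mapLe {G' : SimpleGraph V} (hG : G ≤ G') {u v : V} (p : G.Walk u v) :
    walkSum f (p.mapLe hG) = walkSum f p := by
  induction p with
  | nil => rfl
  | cons h p ih => simpa using ih

/-- A path that uses an edge between its end points is that edge. -/
theorem walkSum_eq_of_isPath_of_mem_edges {u v : V} (p : G.Walk u v) (hp : p.IsPath)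
    (he : s(u, v) ∈ p.edges) : walkSum f p = f u v := by
  cases p with
  | nil => simp at he
  | @cons _ b _ h p =>
    rw [SimpleGraph.Walk.cons_isPath_iff] at hp
    rw [SimpleGraph.Walk.edges_cons, List.mem_cons] at he
    rcases he with he | he
    · have hb : v = b := by
        rcases Sym2.eq_iff.1 he with h' | h'
        · exact h'.2
        · exact absurd h'.1 h.ne
      subst hb
      rw [(SimpleGraph.Walk.isPath_iff_nil.1 hp.1).eq_nil]
      simp
    · exact absurd (p.fst_mem_support_of_mem_edges he) hp.2

variable {f}

/-- If `f` vanishes on all cycles, then every walk can be replaced by a path with the same sum. -/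
theorem exists_isPath_walkSum_eq (hf : ∀ a b, f a b = f b a)
    (hc : ∀ (v : V) (c : G.Walk v v), c.IsCycle → walkSum f c = 0) {u v : V} (p : G.Walk u v) :
    ∃ q : G.Walk u v, q.IsPath ∧ walkSum f q = walkSum f p := by
  classical
  induction p with
  | nil => exact ⟨.nil, by simp, rfl⟩
  | @cons u b v h p ih =>
    obtain ⟨q, hq, hs⟩ := ih
    by_cases hu : u ∈ q.support
    · refine ⟨q.dropUntil u hu, hq.dropUntil hu, ?_⟩
      have hsplit : walkSum f q = walkSum f (q.takeUntil u hu) + walkSum f (q.dropUntil u hu) := by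
        rw [← walkSum_append, SimpleGraph.Walk.take_spec]
      -- The loop cut off is a cycle, or one edge there and back, which counts twice.
      have hloop : f u b + walkSum f (q.takeUntil u hu) = 0 := by
        by_cases he : s(u, b) ∈ (q.takeUntil u hu).edges
        · rw [walkSum_eq_of_isPath_of_mem_edges f _ (hq.takeUntil hu) (by rwa [Sym2.eq_swap]),
            hf b u]
          exact CharTwo.add_self_eq_zero _
        · simpa using hc u (.cons h (q.takeUntil u hu))
            ((SimpleGraph.Walk.cons_isCycle_iff _ h).2 ⟨hq.takeUntil hu, he⟩)
      rw [walkSum_cons, ← hs, hsplit, ← add_assoc, hloop, zero_add]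
    · exact ⟨.cons h q, hq.cons hu, by simp [hs]⟩

theorem walkSum_closed_eq_zero (hf : ∀ a b, f a b = f b a)
    (hc : ∀ (v : V) (c : G.Walk v v), c.IsCycle → walkSum f c = 0) {v : V} (c : G.Walk v v) :
    walkSum f c = 0 := by
  obtain ⟨q, hq, hs⟩ := exists_isPath_walkSum_eq hf hc c
  rw [← hs, (SimpleGraph.Walk.isPath_iff_nil.1 hq).eq_nil, walkSum_nil]

/-- A cochain that vanishes on all cycles is a coboundary. -/
theorem exists_potential (hf : ∀ a b, f a b = f b a)
    (hc : ∀ (v : V) (c : G.Walk v v), c.IsCycle → walkSum f c = 0) :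
    ∃ φ : V → ZMod 2, ∀ a b, G.Adj a b → f a b = φ a + φ b := by
  have hw : ∀ v, Nonempty (G.Walk (G.connectedComponentMk v).out v) := fun v =>
    SimpleGraph.ConnectedComponent.exact (Quot.out_eq _)
  -- Adjacent vertices share the base point of their component, so the two chosen walks and the edge
  -- form a closed walk, of sum zero.
  refine ⟨fun v => walkSum f (hw v).some, fun a b hab => ?_⟩
  have hr : (G.connectedComponentMk a).out = (G.connectedComponentMk b).out := by
    rw [SimpleGraph.ConnectedComponent.sound hab.reachable]
  change f a b = walkSum f (hw a).some + walkSum f (hw b).some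
  generalize (hw a).some = p
  generalize (hw b).some = q
  revert p q
  rw [hr]
  intro p q
  have h := walkSum_closed_eq_zero hf hc (p.append (.cons hab q.reverse))
  rw [walkSum_append, walkSum_cons, walkSum_reverse f hf] at h
  have h2 : ∀ x y z : ZMod 2, x + (y + z) = 0 → y = x + z := by decide
  exact h2 _ _ _ h

end WalkSum

/-- The part of the hexagonal lattice inside `T`. -/
def restrictedGraph (T : Finset Cell) : SimpleGraph Cell where
  Adj a b := hexGraph.Adj a b ∧ a ∈ T ∧ b ∈ T
  symm := ⟨fun _ _ h => ⟨h.1.symm, h.2.2, h.2.1⟩⟩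
  loopless := ⟨fun _ h => h.1.ne rfl⟩

theorem restrictedGraph_le (T : Finset Cell) : restrictedGraph T ≤ hexGraph := fun _ _ h => h.1

/-- If `f` vanishes on the cycles contained in `T`, then it is a coboundary on `T`. -/
theorem exists_potential_on {T : Finset Cell} {f : Cell → Cell → ZMod 2}
    (hf : ∀ a b, f a b = f b a)
    (hc : ∀ (v : Cell) (c : hexGraph.Walk v v), c.IsCycle → (∀ x ∈ c.support, x ∈ T) →
      walkSum f c = 0) :
    ∃ φ : Cell → ZMod 2, ∀ a ∈ T, ∀ b ∈ T, hexGraph.Adj a b → f a b = φ a + φ b := by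
  obtain ⟨φ, hφ⟩ := exists_potential (G := restrictedGraph T) hf (fun v c hcyc => by
    rw [← walkSum_mapLe f (restrictedGraph_le T)]
    refine hc v _ (hcyc.mapLe _) fun x hx => ?_
    rw [SimpleGraph.Walk.support_mapLe_eq_support] at hx
    -- Every position is a vertex of `restrictedGraph T`, so membership in `T` has to be read off
    -- from an edge at `x`.
    obtain ⟨e, he, hxe⟩ := (SimpleGraph.Walk.mem_support_iff_exists_mem_edges_of_not_nil
      hcyc.not_nil).1 hx
    induction e with
    | h a b =>
      have hab := c.adj_of_mem_edges he
      rcases Sym2.mem_iff.1 hxe with rfl | rfl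
      · exact hab.2.1
      · exact hab.2.2)
  exact ⟨φ, fun a ha b hb h => hφ a b ⟨h, ha, hb⟩⟩

/-! ### Crossing parity -/

/-- The parity of the crossings of the edge `a b` with the ray that starts at `y`. -/
def crossing (y a b : Cell) : ZMod 2 :=
  if (height a ≤ height y ∧ height y < height b ∧ a.1 < y.1) ∨
    (height b ≤ height y ∧ height y < height a ∧ b.1 < y.1) then 1 else 0

theorem crossing_symm (y a b : Cell) : crossing y a b = crossing y b a := by
  rw [crossing, crossing]
  exact if_congr or_comm rfl rfl

theorem crossing_mk (r s p q p' q' : ℤ) : crossing (r, s) (p, q) (p', q') =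
    if (2 * q + p ≤ 2 * s + r ∧ 2 * s + r < 2 * q' + p' ∧ p < r) ∨
      (2 * q' + p' ≤ 2 * s + r ∧ 2 * s + r < 2 * q + p ∧ p' < r) then 1 else 0 :=
  if_congr Iff.rfl rfl rfl

open Classical in
theorem walkSum_crossing_eq_countP (y : Cell) {u v : Cell} (p : hexGraph.Walk u v) :
    walkSum (crossing y) p = ((p.darts.countP fun d =>
      decide (UpCrossing y d.fst d.snd ∨ UpCrossing y d.snd d.fst) : ℕ) : ZMod 2) := by
  induction p with
  | nil => simp
  | @cons a b _ h p ih =>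
    rw [walkSum_cons, ih, SimpleGraph.Walk.darts_cons, List.countP_cons, Nat.cast_add, add_comm,
      crossing]
    congr 1
    by_cases h' : UpCrossing y a b ∨ UpCrossing y b a
    · exact (if_pos h').trans (by rw [if_pos (decide_eq_true h'), Nat.cast_one])
    · exact (if_neg h').trans (by rw [if_neg (by simpa using h'), Nat.cast_zero])

theorem walkSum_crossing (y : Cell) {v : Cell} (c : hexGraph.Walk v v) :
    walkSum (crossing y) c = (crossingNumber c y : ZMod 2) :=
  walkSum_crossing_eq_countP y c

theorem walkSum_crossing_eq_zero_iff (y : Cell) {v : Cell} (c : hexGraph.Walk v v) :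
    walkSum (crossing y) c = 0 ↔ ¬ Odd (crossingNumber c y) := by
  rw [walkSum_crossing, ZMod.natCast_eq_zero_iff_even, Nat.not_odd_iff_even]

/-- By the half-open rule a position counts as inside exactly one triangle: the one on its left
whose right corner it is. Triangles of the other orientation contain none. -/
theorem crossing_triangle_up (y c : Cell) :
    crossing y c (c + (0, 1)) + crossing y c (c + (1, 0)) + crossing y (c + (0, 1)) (c + (1, 0)) =
      if c + (1, 0) = y then 1 else 0 := by
  obtain ⟨p, q⟩ := c
  obtain ⟨r, s⟩ := y
  have h : ((p, q) + (1, 0) = ((r, s) : Cell)) ↔ p + 1 = r ∧ q + 0 = s :=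
    Prod.mk.injEq .. ▸ Iff.rfl
  rw [if_congr h rfl rfl]
  simp only [Prod.mk_add_mk, crossing_mk]
  split_ifs <;> first | decide | omega

theorem crossing_triangle_down (y c : Cell) :
    crossing y c (c + (1, -1)) + crossing y c (c + (1, 0)) +
      crossing y (c + (1, -1)) (c + (1, 0)) = 0 := by
  obtain ⟨p, q⟩ := c
  obtain ⟨r, s⟩ := y
  simp only [Prod.mk_add_mk, crossing_mk]
  split_ifs <;> first | decide | omega

theorem hexGraph_adj_iff {a b : Cell} : hexGraph.Adj a b ↔
    (b.1 = a.1 ∧ (b.2 = a.2 + 1 ∨ b.2 = a.2 - 1)) ∨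
    (b.1 = a.1 - 1 ∧ (b.2 = a.2 + 1 ∨ b.2 = a.2)) ∨
    (b.1 = a.1 + 1 ∧ (b.2 = a.2 - 1 ∨ b.2 = a.2)) := by
  obtain ⟨p, q⟩ := a
  obtain ⟨r, s⟩ := b
  change (∃ w : Wall, _) ↔ _
  simp only [Fin.exists_fin_succ, unitVec, Prod.ext_iff]
  simp
  omega

/-! ### Crossing parity around an interior position. -/

section Interior

variable {A B : Finset Cell} {φ : Cell → ZMod 2} {x : Cell}

open Classical in
/-- The crossing cochain modified by the coboundary of `φ` and cut off to the edges that
touch `A`. -/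
def cutCochain (A : Finset Cell) (φ : Cell → ZMod 2) (x a b : Cell) : ZMod 2 :=
  if a ∈ A ∨ b ∈ A then crossing x a b + φ a + φ b else 0

theorem cutCochain_finite_support (A : Finset Cell) (φ : Cell → ZMod 2) (x u v : Cell) :
    (Function.support fun c => cutCochain A φ x (c + u) (c + v)).Finite := by
  refine Set.Finite.subset (((A.image (· - u)) ∪ A.image (· - v)).finite_toSet) fun c hc => ?_
  have : c + u ∈ A ∨ c + v ∈ A := by
    by_contra h
    exact hc (if_neg h)
  simp only [Finset.coe_union, Finset.coe_image, Set.mem_union, Set.mem_image, Finset.mem_coe]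
  exact this.imp (fun h => ⟨_, h, by simp⟩) (fun h => ⟨_, h, by simp⟩)

open Classical in
-- If a triangle touches `A`, an edge of it without an end in `A` has both ends in `B`, where the
-- uncut value is zero anyway. So the cut-off is invisible on this triangle, and the terms of `φ`
-- cancel in pairs.
theorem cutCochain_triangle (hA : ∀ a ∈ A, ∀ b, hexGraph.Adj a b → b ∈ A ∨ b ∈ B)
    (hφ : ∀ a ∈ B, ∀ b ∈ B, hexGraph.Adj a b → crossing x a b = φ a + φ b)
    {a b d : Cell} (hab : hexGraph.Adj a b) (had : hexGraph.Adj a d) (hbd : hexGraph.Adj b d) :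
    cutCochain A φ x a b + cutCochain A φ x a d + cutCochain A φ x b d =
      if a ∈ A ∨ b ∈ A ∨ d ∈ A then crossing x a b + crossing x a d + crossing x b d else 0 := by
  have key : ∀ {a b d : Cell}, hexGraph.Adj a b → hexGraph.Adj a d → hexGraph.Adj b d →
      (a ∈ A ∨ b ∈ A ∨ d ∈ A) → cutCochain A φ x a b = crossing x a b + φ a + φ b := by
    intro a b d hab had hbd h
    by_cases h' : a ∈ A ∨ b ∈ A
    · exact if_pos h'
    · rw [cutCochain, if_neg h']
      have hd : d ∈ A := by tauto
      have ha : a ∈ B := (hA d hd a had.symm).resolve_left (by tauto)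
      have hb : b ∈ B := (hA d hd b hbd.symm).resolve_left (by tauto)
      rw [hφ a ha b hb hab]
      generalize φ a = s
      generalize φ b = t
      revert s t
      decide
  split_ifs with h
  · rw [key hab had hbd h, key had hab hbd.symm (by tauto), key hbd hab.symm had.symm (by tauto)]
    generalize φ a = r
    generalize φ b = s
    generalize φ d = t
    generalize crossing x a b = r'
    generalize crossing x a d = s'
    generalize crossing x b d = t'
    revert r s t r' s' t'
    decide
  · rw [cutCochain, cutCochain, cutCochain, if_neg (by tauto), if_neg (by tauto),
      if_neg (by tauto)]
    simp

/-- The parity of the crossings around `x` is not a coboundary on a set that surrounds `x`. -/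
theorem crossing_not_coboundary (hA : ∀ a ∈ A, ∀ b, hexGraph.Adj a b → b ∈ A ∨ b ∈ B)
    (hx : x ∈ A) :
    ¬ ∀ a ∈ B, ∀ b ∈ B, hexGraph.Adj a b → crossing x a b = φ a + φ b := by
  classical
  intro hφ
  let g := cutCochain A φ x
  have hfin := cutCochain_finite_support A φ x
  have hadj : ∀ (c u v : Cell), hexGraph.Adj u v → hexGraph.Adj (c + u) (c + v) := by
    rintro c u v ⟨w, rfl⟩
    exact ⟨w, by abel⟩
  have h1 : hexGraph.Adj ((0, 0) : Cell) (0, 1) := ⟨0, rfl⟩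
  have h2 : hexGraph.Adj ((0, 0) : Cell) (1, 0) := ⟨5, rfl⟩
  have h3 : hexGraph.Adj ((0, 1) : Cell) (1, 0) := ⟨4, rfl⟩
  have h4 : hexGraph.Adj ((0, 0) : Cell) (1, -1) := ⟨4, rfl⟩
  have h5 : hexGraph.Adj ((1, -1) : Cell) (1, 0) := ⟨0, rfl⟩
  have h0 : ∀ c : Cell, c + (0, 0) = c := fun c => add_zero c
  have hup : ∀ c, g (c + (0, 0)) (c + (0, 1)) + g (c + (0, 0)) (c + (1, 0)) +
      g (c + (0, 1)) (c + (1, 0)) = if c = x - (1, 0) then 1 else 0 := by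
    intro c
    rw [cutCochain_triangle hA hφ (hadj c _ _ h1) (hadj c _ _ h2) (hadj c _ _ h3), h0,
      crossing_triangle_up]
    simp only [eq_sub_iff_add_eq]
    split_ifs with ha hb hb <;> first | rfl | skip
    subst hb
    tauto
  have hdown : ∀ c, g (c + (0, 0)) (c + (1, -1)) + g (c + (0, 0)) (c + (1, 0)) +
      g (c + (1, -1)) (c + (1, 0)) = 0 := by
    intro c
    rw [cutCochain_triangle hA hφ (hadj c _ _ h4) (hadj c _ _ h2) (hadj c _ _ h5), h0,
      crossing_triangle_down, ite_self]
  -- Sum over all triangles of each orientation. Every edge lies in one triangle of each kind, so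
  -- the totals agree up to the translations `e1` and `e2`; yet the first is `1`, from the triangle
  -- with right corner `x`, and the second is `0`.
  have hsumup := finsum_congr hup
  have hsumdown := finsum_congr hdown
  rw [finsum_add_distrib (((hfin _ _).union (hfin _ _)).subset (Function.support_add _ _))
    (hfin _ _), finsum_add_distrib (hfin _ _) (hfin _ _)] at hsumup hsumdown
  have e1 : ∑ᶠ c, g (c + (0, 1)) (c + (1, 0)) = ∑ᶠ c, g (c + (0, 0)) (c + (1, -1)) := by
    rw [← finsum_comp_equiv (Equiv.addRight ((0, 1) : Cell))
      (f := fun c => g (c + (0, 0)) (c + (1, -1)))]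
    refine finsum_congr fun c => ?_
    simp [add_assoc]
  have e2 : ∑ᶠ c, g (c + (1, -1)) (c + (1, 0)) = ∑ᶠ c, g (c + (0, 0)) (c + (0, 1)) := by
    rw [← finsum_comp_equiv (Equiv.addRight ((1, -1) : Cell))
      (f := fun c => g (c + (0, 0)) (c + (0, 1)))]
    refine finsum_congr fun c => ?_
    simp [add_assoc]
  rw [e1, finsum_eq_single _ (x - (1, 0)) (fun c hc => if_neg hc), if_pos rfl] at hsumup
  rw [e2, finsum_zero] at hsumdown
  generalize ∑ᶠ c, g (c + (0, 0)) (c + (0, 1)) = r at hsumup hsumdown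
  generalize ∑ᶠ c, g (c + (0, 0)) (c + (1, 0)) = s at hsumup hsumdown
  generalize ∑ᶠ c, g (c + (0, 0)) (c + (1, -1)) = t at hsumup hsumdown
  revert r s t
  decide

end Interior

/-! ### The target positions are the positions of the shape -/

/-- A cycle that encloses `x` can be shortened along its chords until it is minimal. -/
theorem exists_isMinimalCycle {B : Finset Cell} {x : Cell} (hx : x ∉ B) :
    ∀ (n : ℕ) (v : Cell) (c : hexGraph.Walk v v), c.length = n → c.IsCycle →
      (∀ z ∈ c.support, z ∈ B) → walkSum (crossing x) c ≠ 0 →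
      ∃ (u : Cell) (d : hexGraph.Walk u u), IsMinimalCycle B d ∧ Encloses d x := by
  intro n
  induction n using Nat.strong_induction_on with
  | _ n ih =>
    intro v c hn hc hB hodd
    by_cases hmin : ∀ a ∈ c.support, ∀ b ∈ c.support, hexGraph.Adj a b → s(a, b) ∈ c.edges
    · refine ⟨v, c, ⟨hc, hB, hmin⟩, fun h => hx (hB x h), ?_⟩
      by_contra h
      exact hodd ((walkSum_crossing_eq_zero_iff x c).2 h)
    push Not at hmin
    obtain ⟨a, ha, b, hb, hab, he⟩ := hmin
    have hc' : (c.rotate a ha).IsCycle := hc.rotate ha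
    have hb' : b ∈ (c.rotate a ha).support := (c.mem_support_rotate_iff a ha).2 hb
    have he' : s(a, b) ∉ (c.rotate a ha).edges := fun h =>
      he ((c.rotate_edges a ha).mem_iff.1 h)
    have hB' : ∀ z ∈ (c.rotate a ha).support, z ∈ B := fun z hz =>
      hB z ((c.mem_support_rotate_iff a ha).1 hz)
    have hlen : (c.rotate a ha).length = n := by rw [SimpleGraph.Walk.length_rotate, hn]
    have hsum : walkSum (crossing x) (c.rotate a ha) = walkSum (crossing x) c := by
      rw [SimpleGraph.Walk.rotate, walkSum_append, add_comm, ← walkSum_append,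
        SimpleGraph.Walk.take_spec]
    rw [← hsum] at hodd
    generalize c.rotate a ha = c' at hc' hb' he' hB' hlen hodd
    obtain ⟨p, q, rfl⟩ := SimpleGraph.Walk.mem_support_iff_exists_append.1 hb'
    rw [SimpleGraph.Walk.edges_append, List.mem_append, not_or] at he'
    rw [SimpleGraph.Walk.length_append] at hlen
    rw [walkSum_append] at hodd
    have hlong : ∀ {r s : Cell} (p : hexGraph.Walk r s), hexGraph.Adj r s → s(r, s) ∉ p.edges →
        2 ≤ p.length := by
      intro r s p hrs hp
      cases p with
      | nil => exact absurd rfl hrs.ne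
      | cons h p =>
        cases p with
        | nil => simp at hp
        | cons h' p => simp
    have hp2 := hlong p hab he'.1
    have hq2 := hlong q hab.symm (by rw [Sym2.eq_swap]; exact he'.2)
    have hp : p.IsPath := SimpleGraph.Walk.IsCycle.isPath_of_append_left
      (SimpleGraph.Walk.not_nil_of_ne hab.ne') hc'
    have hq : q.IsPath := SimpleGraph.Walk.IsCycle.isPath_of_append_right
      (SimpleGraph.Walk.not_nil_of_ne hab.ne) hc'
    have hpB : ∀ z ∈ p.support, z ∈ B := fun z hz =>
      hB' z ((SimpleGraph.Walk.mem_support_append_iff _ _).2 (Or.inl hz))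
    have hqB : ∀ z ∈ q.support, z ∈ B := fun z hz =>
      hB' z ((SimpleGraph.Walk.mem_support_append_iff _ _).2 (Or.inr hz))
    -- The chord occurs in both halves, so their sums add up to that of the whole cycle, and one of
    -- them is nonzero. Each half is shorter because the other arc has at least two edges.
    by_cases hodd' : crossing x a b + walkSum (crossing x) q = 0
    · refine ih _ ?_ b (.cons hab.symm p) rfl ((SimpleGraph.Walk.cons_isCycle_iff _ _).2
        ⟨hp, by rw [Sym2.eq_swap]; exact he'.1⟩) ?_ ?_
      · rw [SimpleGraph.Walk.length_cons]
        omega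
      · intro z hz
        rw [SimpleGraph.Walk.support_cons, List.mem_cons] at hz
        rcases hz with rfl | hz
        · exact hpB _ p.end_mem_support
        · exact hpB z hz
      · rw [walkSum_cons, crossing_symm]
        revert hodd hodd'
        generalize walkSum (crossing x) p = r
        generalize walkSum (crossing x) q = s
        generalize crossing x a b = t
        revert r s t
        decide
    · refine ih _ ?_ a (.cons hab q) rfl ((SimpleGraph.Walk.cons_isCycle_iff _ _).2
        ⟨hq, he'.2⟩) ?_ ?_
      · rw [SimpleGraph.Walk.length_cons]
        omega
      · intro z hz
        rw [SimpleGraph.Walk.support_cons, List.mem_cons] at hz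
        rcases hz with rfl | hz
        · exact hqB _ q.end_mem_support
        · exact hqB z hz
      · rwa [walkSum_cons]

/-- Hole-freeness gives one inclusion. For the other, a position of `S` off the perimeter that no
minimal cycle encloses would make the crossing parity a coboundary on the perimeter, although the
interior of `S` has all its neighbours in itself or in the perimeter. -/
theorem targetOf_perimeter {S : Finset Cell} (hS : HoleFree S) :
    targetOf (perimeter S) = (S : Set Cell) := by
  ext x
  have hsub : ∀ z ∈ perimeter S, z ∈ S := fun z hz => (Finset.mem_filter.1 hz).1
  constructor
  · rintro (h | ⟨v, c, hc, hx⟩)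
    · exact hsub x h
    · exact hS v c hc.1 (fun z hz => hsub z (hc.2.1 z hz)) x hx
  · intro hxS
    by_cases hxB : x ∈ perimeter S
    · exact Or.inl hxB
    right
    by_contra hno
    obtain ⟨φ, hφ⟩ := exists_potential_on (T := perimeter S) (crossing_symm x)
      (fun v c hc hcB => by
        by_contra h
        exact hno (exists_isMinimalCycle hxB _ v c rfl hc hcB h))
    refine crossing_not_coboundary (A := S \ perimeter S) (B := perimeter S) (φ := φ) (x := x)
      ?_ (Finset.mem_sdiff.2 ⟨hxS, hxB⟩) hφ
    rintro a ha b ⟨w, rfl⟩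
    rw [Finset.mem_sdiff] at ha
    have hbS : a + unitVec w ∈ S := by
      by_contra h
      exact ha.2 (Finset.mem_filter.2 ⟨ha.1, w, h⟩)
    by_cases h : a + unitVec w ∈ perimeter S
    · exact Or.inr h
    · exact Or.inl (Finset.mem_sdiff.2 ⟨hbS, h⟩)

/-- In a hole-free shape, the crossing parity around a position outside is a coboundary. -/
theorem HoleFree.exists_potential {S : Finset Cell} (hS : HoleFree S) {y : Cell} (hy : y ∉ S) :
    ∃ φ : Cell → ZMod 2, ∀ a ∈ S, ∀ b ∈ S, hexGraph.Adj a b → crossing y a b = φ a + φ b :=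
  exists_potential_on (crossing_symm y) fun v c hc hcS => by
    rw [walkSum_crossing_eq_zero_iff]
    exact fun h => hy (hS v c hc hcS y ⟨fun h' => hy (hcS y h'), h⟩)

/-! ### Column segments of a shape -/

/-- The column of `x` together with the rows of the maximal contiguous segment of `S` that
contains `x`. -/
def seg (S : Finset Cell) (x : Cell) : ℤ × Set ℤ :=
  (x.1, {q | ∀ k ∈ Set.uIcc q x.2, (x.1, k) ∈ S})

variable {S : Finset Cell}

theorem seg_eq_iff {x y : Cell} (hx : x ∈ S) :
    seg S x = seg S y ↔ x.1 = y.1 ∧ ∀ k ∈ Set.uIcc x.2 y.2, (x.1, k) ∈ S := by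
  obtain ⟨p, q⟩ := x
  obtain ⟨r, s⟩ := y
  simp only [seg, Prod.mk.injEq]
  constructor
  · rintro ⟨rfl, h⟩
    refine ⟨rfl, ?_⟩
    have hq : q ∈ {t | ∀ k ∈ Set.uIcc t q, (p, k) ∈ S} := by
      intro k hk
      rw [Set.uIcc_self, Set.mem_singleton_iff] at hk
      rwa [hk]
    rw [h] at hq
    exact hq
  · rintro ⟨rfl, h⟩
    refine ⟨rfl, ?_⟩
    ext t
    simp only [Set.mem_ofPred_eq]
    constructor
    · intro ht k hk
      rcases Set.uIcc_subset_uIcc_union_uIcc (b := q) hk with h' | h'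
      · exact ht k h'
      · exact h k h'
    · intro ht k hk
      rcases Set.uIcc_subset_uIcc_union_uIcc (b := s) hk with h' | h'
      · exact ht k h'
      · exact h k (by rwa [Set.uIcc_comm])

theorem column_eq_of_seg_eq {x y : Cell} (h : seg S x = seg S y) : x.1 = y.1 :=
  congrArg (fun T : ℤ × Set ℤ => T.1) h

theorem seg_eq_of_adj {x y : Cell} (hx : x ∈ S) (hy : y ∈ S) (h : hexGraph.Adj x y)
    (hc : x.1 = y.1) : seg S x = seg S y := by
  refine (seg_eq_iff hx).2 ⟨hc, fun k hk => ?_⟩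
  have : k = x.2 ∨ k = y.2 := by
    rw [hexGraph_adj_iff] at h
    rw [Set.mem_uIcc] at hk
    omega
  rcases this with rfl | rfl
  · exact hx
  · rw [hc]
    exact hy

theorem mem_of_seg_eq {x y : Cell} (hx : x ∈ S) (h : seg S x = seg S y) {k : ℤ}
    (hk : (x.2 ≤ k ∧ k ≤ y.2) ∨ (y.2 ≤ k ∧ k ≤ x.2)) :
    (x.1, k) ∈ S ∧ seg S (x.1, k) = seg S x := by
  have h' := (seg_eq_iff hx).1 h
  refine ⟨h'.2 k (Set.mem_uIcc.2 hk), Eq.symm ?_⟩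
  refine (seg_eq_iff hx).2 ⟨rfl, fun j hj => h'.2 j ?_⟩
  rw [Set.mem_uIcc] at hj ⊢
  simp only at hj
  omega

/-- The adjacency graph of the column segments. -/
def segGraph (S : Finset Cell) : SimpleGraph (ℤ × Set ℤ) where
  Adj a b := a ≠ b ∧ ∃ x ∈ S, ∃ y ∈ S, hexGraph.Adj x y ∧ seg S x = a ∧ seg S y = b
  symm := ⟨fun _ _ ⟨hne, x, hx, y, hy, h, hxa, hyb⟩ => ⟨hne.symm, y, hy, x, hx, h.symm, hyb, hxa⟩⟩
  loopless := ⟨fun _ h => h.1 rfl⟩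

theorem segGraph_adj_of_adj {x y : Cell} (hx : x ∈ S) (hy : y ∈ S) (h : hexGraph.Adj x y)
    (hc : x.1 ≠ y.1) : (segGraph S).Adj (seg S x) (seg S y) :=
  ⟨fun h' => hc (column_eq_of_seg_eq h'), x, hx, y, hy, h, rfl, rfl⟩

theorem segGraph_adj_column {a b : ℤ × Set ℤ} (h : (segGraph S).Adj a b) :
    b.1 = a.1 + 1 ∨ b.1 = a.1 - 1 := by
  obtain ⟨hne, x, hx, y, hy, hxy, rfl, rfl⟩ := h
  have hc : x.1 ≠ y.1 := fun hc => hne (seg_eq_of_adj hx hy hxy hc)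
  rw [hexGraph_adj_iff] at hxy
  change y.1 = x.1 + 1 ∨ y.1 = x.1 - 1
  omega

theorem eq_of_forall_succ_eq {α : Type*} (g : ℤ → α) (a b : ℤ)
    (h : ∀ k, k ∈ Set.uIcc a b → k + 1 ∈ Set.uIcc a b → g k = g (k + 1)) : g a = g b := by
  wlog hab : a ≤ b generalizing a b
  · exact (this b a (by rwa [Set.uIcc_comm]) (by omega)).symm
  rw [Set.uIcc_of_le hab] at h
  have : ∀ k, a ≤ k → k ≤ b → g a = g k := by
    intro k hk
    induction k, hk using Int.leInduction with
    | base => exact fun _ => rfl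
    | succ k hk ih =>
      intro hkb
      rw [ih (by omega)]
      exact h k ⟨hk, by omega⟩ ⟨by omega, hkb⟩
  exact this b hab le_rfl

/-- Two different segments next to the segment `Q`, in the column to its right, cannot be joined
by a chain of segments that avoids `Q` and does not go further left than `Q`. -/
theorem HoleFree.not_joined (hS : HoleFree S) {A B Q : ℤ × Set ℤ} (r : (segGraph S).Walk A B)
    (hQ : Q ∉ r.support) (hmin : ∀ T ∈ r.support, Q.1 ≤ T.1) (hAB : A ≠ B)
    {a a' b b' : Cell} (ha : a ∈ S) (ha' : a' ∈ S) (hb : b ∈ S) (hb' : b' ∈ S)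
    (hsa : seg S a = A) (hsa' : seg S a' = Q) (hsb : seg S b = B) (hsb' : seg S b' = Q)
    (haa : hexGraph.Adj a a') (hbb : hexGraph.Adj b b') (hlt : a.2 < b.2) : False := by
  have hca : a.1 ≠ a'.1 := fun h => hQ (by
    rw [← hsa', ← seg_eq_of_adj ha ha' haa h, hsa]
    exact r.start_mem_support)
  have hcb : b.1 ≠ b'.1 := fun h => hQ (by
    rw [← hsb', ← seg_eq_of_adj hb hb' hbb h, hsb]
    exact r.end_mem_support)
  obtain ⟨p, hp⟩ : ∃ p, p = Q.1 := ⟨_, rfl⟩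
  have hpa' : a'.1 = p := by rw [hp, ← hsa']; rfl
  have hpb' : b'.1 = p := by rw [hp, ← hsb']; rfl
  have hpa : p ≤ a.1 := by
    have := hmin A r.start_mem_support
    rw [← hsa, ← hp] at this
    exact this
  have hpb : p ≤ b.1 := by
    have := hmin B r.end_mem_support
    rw [← hsb, ← hp] at this
    exact this
  have haa' := hexGraph_adj_iff.1 haa
  have hbb' := hexGraph_adj_iff.1 hbb
  obtain ⟨s, hs1, hs2, hsS⟩ : ∃ s, a.2 ≤ s ∧ s ≤ b.2 ∧ (p + 1, s) ∉ S := by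
    by_contra hno
    push Not at hno
    apply hAB
    rw [← hsa, ← hsb]
    refine (seg_eq_iff ha).2 ⟨by omega, fun k hk => ?_⟩
    rw [Set.mem_uIcc] at hk
    have hk' := hno k (by omega) (by omega)
    rwa [show a.1 = p + 1 by omega]
  have hsa1 : a.2 ≠ s := fun h => hsS (by
    rw [show ((p + 1, s) : Cell) = a from Prod.ext (by simp only; omega) h.symm]; exact ha)
  have hsb1 : b.2 ≠ s := fun h => hsS (by
    rw [show ((p + 1, s) : Cell) = b from Prod.ext (by simp only; omega) h.symm]; exact hb)
  obtain ⟨φ, hφ⟩ := hS.exists_potential hsS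
  have hQmem : ∀ k, a'.2 ≤ k → k ≤ b'.2 → (p, k) ∈ S ∧ seg S (p, k) = Q := by
    intro k h1 h2
    have := mem_of_seg_eq ha' (hsa'.trans hsb'.symm) (k := k) (Or.inl ⟨h1, h2⟩)
    rwa [hpa', hsa'] at this
  -- Within the columns from `p` on, the ray from the gap meets only the edge from `(p, s)` to `(p,
  -- s + 1)`, and this edge lies in `Q`.
  have hφeq : ∀ u ∈ S, ∀ v ∈ S, hexGraph.Adj u v → p ≤ u.1 → p ≤ v.1 →
      (u.1 ≠ v.1 ∨ seg S u ≠ Q) → φ u = φ v := by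
    rintro ⟨u1, u2⟩ hu ⟨v1, v2⟩ hv huv hu1 hv1 hne
    have h := hφ _ hu _ hv huv
    have hnot : u1 = v1 → ¬ (u1 = p ∧ (u2 = s ∨ u2 = s + 1)) := by
      rintro huv1 ⟨rfl, h'⟩
      refine hne.elim (fun h => h huv1) fun h => h (hQmem u2 ?_ ?_).2 <;> omega
    have hzero : crossing (p + 1, s) (u1, u2) (v1, v2) = 0 := by
      rw [crossing_mk, if_neg]
      rw [hexGraph_adj_iff] at huv
      simp only at huv hu1 hv1
      omega
    rw [hzero] at h
    revert h
    generalize φ (u1, u2) = x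
    generalize φ (v1, v2) = y
    revert x y
    decide
  have hφseg : ∀ u ∈ S, ∀ v ∈ S, seg S u = seg S v → seg S u ≠ Q → p ≤ u.1 → φ u = φ v := by
    intro u hu v hv huv hne hu1
    have hc : u.1 = v.1 := column_eq_of_seg_eq huv
    have := eq_of_forall_succ_eq (fun k => φ (u.1, k)) u.2 v.2 (fun k hk hk1 => by
      rw [Set.mem_uIcc] at hk hk1
      have h1 := mem_of_seg_eq hu huv hk
      have h2 := mem_of_seg_eq hu huv hk1
      exact hφeq _ h1.1 _ h2.1 (hexGraph_adj_iff.2 (by simp)) hu1 hu1 (Or.inr (by rwa [h1.2])))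
    simp only [Prod.mk.eta] at this
    rw [this, hc]
  have hwalk : ∀ {T T' : ℤ × Set ℤ} (r : (segGraph S).Walk T T'), Q ∉ r.support →
      (∀ R ∈ r.support, Q.1 ≤ R.1) → ∀ u ∈ S, ∀ v ∈ S, seg S u = T → seg S v = T' →
      φ u = φ v := by
    intro T T' r
    induction r with
    | nil =>
      intro hQr hmr u hu v hv hsu hsv
      rw [SimpleGraph.Walk.support_nil, List.mem_singleton] at hQr
      refine hφseg u hu v hv (hsu.trans hsv.symm) (by rw [hsu]; exact Ne.symm hQr) ?_
      rw [hp]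
      have := hmr _ (SimpleGraph.Walk.start_mem_support _)
      rwa [← hsu] at this
    | @cons T R T' h r ih =>
      intro hQr hmr u hu v hv hsu hsv
      rw [SimpleGraph.Walk.support_cons, List.mem_cons, not_or] at hQr
      have hT : p ≤ T.1 := by
        rw [hp]
        exact hmr T (SimpleGraph.Walk.start_mem_support _)
      have hR : p ≤ R.1 := by
        rw [hp]
        exact hmr R (List.mem_cons_of_mem _ r.start_mem_support)
      obtain ⟨hne, x, hx, y, hy, hxy, rfl, rfl⟩ := h
      rw [hφseg u hu x hx hsu (by rw [hsu]; exact Ne.symm hQr.1) (by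
          have : u.1 = x.1 := column_eq_of_seg_eq hsu
          rw [this]; exact hT),
        hφeq x hx y hy hxy hT hR (Or.inr (Ne.symm hQr.1))]
      exact ih hQr.2 (fun R hR => hmr R (List.mem_cons_of_mem _ hR)) y hy v hv rfl hsv
  have h1 : φ a = φ b := hwalk r hQ hmin a ha b hb hsa hsb
  have h2 : φ a = φ a' := hφeq a ha a' ha' haa hpa (by omega) (Or.inl hca)
  have h3 : φ b = φ b' := hφeq b hb b' hb' hbb hpb (by omega) (Or.inl hcb)
  -- Along `Q` the potential flips exactly once between `a'` and `b'`, while the chain that avoids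
  -- `Q` shows that it does not change.
  have h4 := eq_of_forall_succ_eq (fun k => φ (p, k) + if s < k then 1 else 0) a'.2 b'.2
    (fun k hk hk1 => by
      rw [Set.uIcc_of_le (by omega), Set.mem_Icc] at hk hk1
      have h := hφ _ (hQmem k hk.1 hk.2).1 _ (hQmem (k + 1) hk1.1 hk1.2).1
        (hexGraph_adj_iff.2 (by simp))
      rw [crossing_mk] at h
      revert h
      generalize φ (p, k) = x
      generalize φ (p, k + 1) = y
      split_ifs <;> first | omega | (revert x y; decide))
  rw [if_neg (by omega), if_pos (by omega), ← hpa', Prod.mk.eta, hpa', ← hpb', Prod.mk.eta,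
    ← h2, ← h3, h1] at h4
  revert h4
  generalize φ b = x
  revert x
  decide

/-- The column segments of a hole-free shape form a forest. -/
theorem HoleFree.segGraph_isAcyclic (hS : HoleFree S) : (segGraph S).IsAcyclic := by
  classical
  intro v c hc
  -- Both neighbours of a leftmost segment on the cycle lie in the column to its right, and the rest
  -- of the cycle joins them while avoiding it.
  obtain ⟨Q, hQ, hmin⟩ := c.support.toFinset.exists_min_image Prod.fst
    ⟨v, List.mem_toFinset.2 c.start_mem_support⟩
  rw [List.mem_toFinset] at hQ
  have hc' := hc.rotate hQ
  have hmin' : ∀ T ∈ (c.rotate Q hQ).support, Q.1 ≤ T.1 := fun T hT =>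
    hmin T (List.mem_toFinset.2 ((c.mem_support_rotate_iff Q hQ).1 hT))
  generalize c.rotate Q hQ = d at hc' hmin'
  cases d with
  | nil => exact hc'.not_nil .nil
  | @cons _ A _ hA p =>
    rw [SimpleGraph.Walk.cons_isCycle_iff] at hc'
    obtain ⟨hp, he⟩ := hc'
    have hp' := hp.reverse
    have he' : s(Q, A) ∉ p.reverse.edges := by simpa using he
    have hmr : ∀ T ∈ p.reverse.support, Q.1 ≤ T.1 := fun T hT =>
      hmin' T (List.mem_cons_of_mem _ (by simpa using hT))
    generalize p.reverse = q at hp' he' hmr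
    cases q with
    | nil => exact hA.ne rfl
    | @cons _ B _ hB r =>
      rw [SimpleGraph.Walk.cons_isPath_iff] at hp'
      have hBA : B ≠ A := by
        rintro rfl
        simp at he'
      have hmr' : ∀ T ∈ r.support, Q.1 ≤ T.1 := fun T hT => hmr T (List.mem_cons_of_mem _ hT)
      have hcA := segGraph_adj_column hA
      have hcB := segGraph_adj_column hB
      have hmA := hmr' A r.end_mem_support
      have hmB := hmr' B r.start_mem_support
      obtain ⟨-, a', ha', a, ha, haa, hsa', hsa⟩ := hA
      obtain ⟨-, b', hb', b, hb, hbb, hsb', hsb⟩ := hB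
      rcases lt_trichotomy a.2 b.2 with h | h | h
      · exact hS.not_joined r.reverse (by simpa using hp'.2) (by simpa using hmr') hBA.symm
          ha ha' hb hb' hsa hsa' hsb hsb' haa.symm hbb.symm h
      · refine hBA ?_
        have hc : a.1 = b.1 := by
          have h1 : a.1 = A.1 := by rw [← hsa]; rfl
          have h2 : b.1 = B.1 := by rw [← hsb]; rfl
          omega
        rw [← hsa, ← hsb, Prod.ext hc h]
      · exact hS.not_joined r hp'.2 hmr' hBA hb hb' ha ha' hsb hsb' hsa hsa' hbb.symm haa.symm h

/-! ### Depth -/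

/-- The distance of the segment of `x` from the segment of the root. -/
def depth (S : Finset Cell) (x : Cell) : ℕ :=
  (segGraph S).dist (seg S (0, 0)) (seg S x)

/-- The segment of `x` is joined to the segment of the root. -/
def Joined (S : Finset Cell) (x : Cell) : Prop :=
  (segGraph S).Reachable (seg S (0, 0)) (seg S x)

theorem depth_congr {x y : Cell} (h : seg S x = seg S y) : depth S x = depth S y := by
  rw [depth, depth, h]

theorem Joined.congr {x y : Cell} (hj : Joined S x) (h : seg S x = seg S y) : Joined S y := by
  rwa [Joined, ← h]

theorem Joined.of_adj {x y : Cell} (hj : Joined S x) (hx : x ∈ S) (hy : y ∈ S)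
    (h : hexGraph.Adj x y) : Joined S y := by
  by_cases hc : x.1 = y.1
  · exact hj.congr (seg_eq_of_adj hx hy h hc)
  · exact hj.trans (segGraph_adj_of_adj hx hy h hc).reachable

/-- This makes `segGraph` bipartite, so adjacent segments cannot be equally far from the root. -/
theorem column_parity_of_walk {a b : ℤ × Set ℤ} (p : (segGraph S).Walk a b) :
    (b.1 - a.1) % 2 = (p.length : ℤ) % 2 := by
  induction p with
  | nil => simp
  | cons h p ih =>
    have := segGraph_adj_column h
    rw [SimpleGraph.Walk.length_cons]
    push_cast
    omega

/-- Adjacent positions in different columns have different depths. -/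
theorem depth_ne_of_adj {x y : Cell} (hj : Joined S x) (hx : x ∈ S) (hy : y ∈ S)
    (h : hexGraph.Adj x y) (hc : x.1 ≠ y.1) : depth S x ≠ depth S y := by
  have hadj := segGraph_adj_column (segGraph_adj_of_adj hx hy h hc)
  obtain ⟨p, hp⟩ := hj.exists_walk_length_eq_dist
  obtain ⟨q, hq⟩ := (hj.of_adj hx hy h).exists_walk_length_eq_dist
  have h1 := column_parity_of_walk p
  have h2 := column_parity_of_walk q
  change p.length = depth S x at hp
  change q.length = depth S y at hq
  omega

/-- A shortest path from `A` to `o` cannot pass through `Q`, which is farther from `o`. Uniqueness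
of paths in a forest then determines the lower neighbour of `Q`. -/
theorem exists_isPath_of_lt {Q A : ℤ × Set ℤ} {o : ℤ × Set ℤ} (h : (segGraph S).Adj Q A)
    (hr : (segGraph S).Reachable o A) (hlt : (segGraph S).dist o A < (segGraph S).dist o Q) :
    ∃ p : (segGraph S).Walk A o, (SimpleGraph.Walk.cons h p).IsPath := by
  classical
  obtain ⟨p, hp, hlen⟩ := hr.symm.exists_path_of_dist
  refine ⟨p, hp.cons fun hQ => ?_⟩
  have h1 := SimpleGraph.dist_le (p.dropUntil Q hQ)
  have h2 := p.length_dropUntil_le_length hQ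
  rw [SimpleGraph.dist_comm] at h1 hlen
  omega

/-- A segment has at most one adjacent segment of smaller depth. -/
theorem HoleFree.seg_eq_of_depth_lt (hS : HoleFree S) {x y a b : Cell} (hx : x ∈ S) (hy : y ∈ S)
    (ha : a ∈ S) (hb : b ∈ S) (hj : Joined S x) (hxy : seg S x = seg S y)
    (hxa : hexGraph.Adj x a) (hyb : hexGraph.Adj y b) (hda : depth S a < depth S x)
    (hdb : depth S b < depth S y) : seg S a = seg S b := by
  have hca : x.1 ≠ a.1 := fun h =>
    absurd (depth_congr (seg_eq_of_adj hx ha hxa h)) hda.ne'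
  have hcb : y.1 ≠ b.1 := fun h =>
    absurd (depth_congr (seg_eq_of_adj hy hb hyb h)) hdb.ne'
  have hA := segGraph_adj_of_adj hx ha hxa hca
  have hB := segGraph_adj_of_adj hy hb hyb hcb
  rw [← hxy] at hB
  obtain ⟨p, hp⟩ := exists_isPath_of_lt hA (hj.of_adj hx ha hxa) hda
  obtain ⟨q, hq⟩ := exists_isPath_of_lt hB ((hj.congr hxy).of_adj hy hb hyb)
    (by rw [hxy]; exact hdb)
  have := congrArg Subtype.val
    ((hS.segGraph_isAcyclic.subsingleton_path _ _).elim ⟨_, hp⟩ ⟨_, hq⟩)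
  simp only [SimpleGraph.Walk.cons.injEq] at this
  exact this.1

/-! ### Wall status in terms of the shape -/

theorem unitVec_zero : unitVec 0 = (0, 1) := rfl
theorem unitVec_one : unitVec 1 = (-1, 1) := rfl
theorem unitVec_two : unitVec 2 = (-1, 0) := rfl
theorem unitVec_three : unitVec 3 = (0, -1) := rfl
theorem unitVec_four : unitVec 4 = (1, -1) := rfl
theorem unitVec_five : unitVec 5 = (1, 0) := rfl

theorem status_eq_null_iff (hS : HoleFree S) {X : Finset Cell} {x : Cell} {w : Wall} :
    status (perimeter S) X x w = .null ↔ x + unitVec w ∉ S := by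
  rw [status, targetOf_perimeter hS, Finset.mem_coe]
  split_ifs <;> simp_all

theorem status_eq_free_iff (hS : HoleFree S) {X : Finset Cell} {x : Cell} {w : Wall} :
    status (perimeter S) X x w = .free ↔ x + unitVec w ∈ S ∧ x + unitVec w ∉ X := by
  rw [status, targetOf_perimeter hS, Finset.mem_coe]
  split_ifs <;> simp_all

theorem status_eq_occupied_iff (hS : HoleFree S) {X : Finset Cell} {x : Cell} {w : Wall} :
    status (perimeter S) X x w = .occupied ↔ x + unitVec w ∈ S ∧ x + unitVec w ∈ X := by
  rw [status, targetOf_perimeter hS, Finset.mem_coe]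
  split_ifs <;> simp_all

theorem colSegment_perimeter (hS : HoleFree S) (p r : ℤ) :
    colSegment (perimeter S) p r = (seg S (p, r)).2 := by
  simp only [colSegment, targetOf_perimeter hS, Finset.mem_coe, seg]

theorem mem_seg_iff {x : Cell} (hx : x ∈ S) {k : ℤ} :
    k ∈ (seg S x).2 ↔ (x.1, k) ∈ S ∧ seg S (x.1, k) = seg S x := by
  have h : k ∈ (seg S x).2 ↔ ∀ j ∈ Set.uIcc k x.2, (x.1, j) ∈ S := Iff.rfl
  rw [h]
  constructor
  · intro h
    refine ⟨h k Set.left_mem_uIcc, Eq.symm ?_⟩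
    exact (seg_eq_iff hx).2 ⟨rfl, fun j hj => h j (by rwa [Set.uIcc_comm])⟩
  · rintro ⟨hk, h⟩
    exact ((seg_eq_iff hk).1 h).2

theorem Flank.mem_left {w : Wall} : w ∈ Flank.left.walls ↔ w = 1 ∨ w = 2 := by
  simp [Flank.walls]

theorem Flank.mem_right {w : Wall} : w ∈ Flank.right.walls ↔ w = 4 ∨ w = 5 := by
  simp [Flank.walls]

/-! ### Nucleation sites -/

/-- The geometric condition behind a nucleation flag: `x` touches the segment next to its flank
`F` in a single point, or it is selected by the midpoint rule. -/
def IsNucleationSite (S : Finset Cell) (x : Cell) (F : Flank) : Prop :=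
  (∃ w ∈ F.walls, x + unitVec w ∈ S ∧ x + unitVec (w - 1) ∉ S ∧ x + unitVec (w + 1) ∉ S) ∨
    roleFromColumn (perimeter S) x F = true

/-- The flag depends on the occupied positions at attachment, the geometric condition does not; so
flags set at different times become comparable. -/
theorem isNucleationSite_of_nucleation (hS : HoleFree S) {X : Finset Cell} {x : Cell} {F : Flank}
    (h : nucleation (perimeter S) (status (perimeter S) X x) x F = true) :
    IsNucleationSite S x F := by
  unfold nucleation roleFromSelf at h
  split_ifs at h with h1 h2
  · obtain ⟨w, hw, hf, hn, hn'⟩ := h2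
    exact Or.inl ⟨w, hw, ((status_eq_free_iff hS).1 hf).1, (status_eq_null_iff hS).1 hn,
      (status_eq_null_iff hS).1 hn'⟩
  · exact Or.inr h

theorem nucleation_eq_false {B : Finset Cell} {s : StatusVec} {x : Cell} {F : Flank}
    (h : ∀ w ∈ F.walls, s w ≠ .free) : nucleation B s x F = false := by
  have h' : ¬ ∃ w ∈ F.walls, s w = .free := fun ⟨w, hw, hf⟩ => h w hw hf
  simp only [nucleation, roleFromSelf, if_neg h']

theorem row_lt_of_notMem {x y : Cell} (hx : x ∈ S) (h : seg S x = seg S y) {k : ℤ}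
    (hk : (x.1, k) ∉ S) : (x.2 < k → y.2 < k) ∧ (k < x.2 → k < y.2) := by
  constructor
  · intro h1
    by_contra h2
    exact hk (mem_of_seg_eq hx h (Or.inl ⟨h1.le, by omega⟩)).1
  · intro h1
    by_contra h2
    exact hk (mem_of_seg_eq hx h (Or.inr ⟨by omega, h1.le⟩)).1

/-- A segment that touches `x` between two null walls touches no other position of the segment
of `x`. -/
theorem eq_of_single_contact {F : Flank} {x x' y y' : Cell} (hx : x ∈ S) (hy : y ∈ S)
    (hxx : seg S x = seg S x') (hyy : seg S y = seg S y')
    (hxy : hexGraph.Adj x y) (hxy' : hexGraph.Adj x' y') (hc : y.1 = x.1 + F.dir)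
    (h : ∃ w ∈ F.walls, x + unitVec w ∈ S ∧ x + unitVec (w - 1) ∉ S ∧ x + unitVec (w + 1) ∉ S) :
    x = x' := by
  obtain ⟨w, hw, hwS, hw1, hw2⟩ := h
  have hcx := column_eq_of_seg_eq hxx
  have hcy := column_eq_of_seg_eq hyy
  obtain ⟨p, q⟩ := x
  obtain ⟨p', q'⟩ := x'
  obtain ⟨r, s⟩ := y
  obtain ⟨r', s'⟩ := y'
  rw [hexGraph_adj_iff] at hxy hxy'
  simp only at hcx hcy hc hxy hxy'
  subst hcx hcy hc
  -- The missing rows make one segment end at `x` and the other at `y`, extending in opposite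
  -- directions, so no second pair of their positions is adjacent.
  have key : ∀ k l, (p, k) ∉ S → (p + F.dir, l) ∉ S →
      ((q < k → q' < k) ∧ (k < q → k < q')) ∧ ((s < l → s' < l) ∧ (l < s → l < s')) ∧ s ≠ l := by
    intro k l hk hl
    exact ⟨row_lt_of_notMem hx hxx hk, row_lt_of_notMem hy hyy hl, fun h => hl (h ▸ hy)⟩
  refine Prod.ext rfl ?_
  cases F with
  | left =>
    simp only [Flank.dir] at *
    rcases Flank.mem_left.1 hw with rfl | rfl
    · have := key (q + 1) q (by simpa [unitVec_zero] using hw1)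
        (by simpa [unitVec_two, show (1 + 1 : Wall) = 2 from rfl] using hw2)
      omega
    · have := key (q + -1) (q + 1)
        (by simpa [unitVec_three, show (2 + 1 : Wall) = 3 from rfl] using hw2)
        (by simpa [unitVec_one, show (2 - 1 : Wall) = 1 from rfl] using hw1)
      omega
  | right =>
    simp only [Flank.dir] at *
    rcases Flank.mem_right.1 hw with rfl | rfl
    · have := key (q + -1) q (by simpa [unitVec_three, show (4 - 1 : Wall) = 3 from rfl] using hw1)
        (by simpa [unitVec_five, show (4 + 1 : Wall) = 5 from rfl] using hw2)
      omega
    · have := key (q + 1) (q + -1)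
        (by simpa [unitVec_zero, show (5 + 1 : Wall) = 0 from rfl] using hw2)
        (by simpa [unitVec_four, show (5 - 1 : Wall) = 4 from rfl] using hw1)
      omega

/-- The midpoint rule, stated for the segment of a position `y` next to the flank `F`. -/
theorem midpoint_rule (hS : HoleFree S) {F : Flank} {x y : Cell} (hy : y ∈ S)
    (hxy : hexGraph.Adj x y) (hc : y.1 = x.1 + F.dir)
    (h : roleFromColumn (perimeter S) x F = true) :
    x.2 = midRow (seg S y).2 ∨ (midRow (seg S y).2 ∉ (seg S x).2 ∧
      IsNearestConnection (seg S y).2 (seg S x).2 x.2) := by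
  simp only [roleFromColumn, decide_eq_true_eq] at h
  obtain ⟨Q, ⟨r, hr, rfl⟩, ⟨w, hw, hwQ⟩, h⟩ := h
  rw [targetOf_perimeter hS, Finset.mem_coe] at hr
  rw [colSegment_perimeter hS] at hwQ h
  rw [colSegment_perimeter hS] at h
  -- The two positions faced by a flank are consecutive in their column, so those in `S` belong to
  -- one segment.
  have hQ : seg S (x.1 + F.dir, r) = seg S y := by
    obtain ⟨h1, h2⟩ := (mem_seg_iff hr).1 hwQ
    rw [← h2]
    refine (seg_eq_iff h1).2 ⟨hc.symm, fun k hk => ?_⟩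
    have : k = (x + unitVec w).2 ∨ k = y.2 := by
      rw [Set.mem_uIcc] at hk
      rw [hexGraph_adj_iff] at hxy
      cases F with
      | left =>
        simp only [Flank.dir] at *
        rcases Flank.mem_left.1 hw with rfl | rfl
        · simp only [unitVec_one, Prod.snd_add] at *
          omega
        · simp only [unitVec_two, Prod.snd_add] at *
          omega
      | right =>
        simp only [Flank.dir] at *
        rcases Flank.mem_right.1 hw with rfl | rfl
        · simp only [unitVec_four, Prod.snd_add] at *
          omega
        · simp only [unitVec_five, Prod.snd_add] at *
          omega
    rcases this with rfl | rfl
    · exact h1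
    · rw [← hc]
      exact hy
  rw [hQ] at h
  split_ifs at h with h1 h2
  · exact Or.inl h1
  · exact Or.inr ⟨h2, h⟩

/-- Two distinct nearest rows would lie on opposite sides of the midpoint, which would then belong
to the order-convex `Q₀`; that case is excluded by the rule. -/
theorem midpoint_rule_unique {Q Q₀ : Set ℤ} (hQ₀ : Q₀.OrdConnected) {a b : ℤ} (ha : a ∈ Q₀)
    (hb : b ∈ Q₀)
    (h : a = midRow Q ∨ (midRow Q ∉ Q₀ ∧ IsNearestConnection Q Q₀ a))
    (h' : b = midRow Q ∨ (midRow Q ∉ Q₀ ∧ IsNearestConnection Q Q₀ b)) : a = b := by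
  generalize hm : midRow Q = m at h h'
  rcases h with rfl | ⟨hmQ, h⟩
  · rcases h' with rfl | ⟨hmQ, -⟩
    · rfl
    · exact absurd ha hmQ
  rcases h' with rfl | ⟨-, h'⟩
  · exact absurd hb hmQ
  have h1 := h.2 b h'.1
  have h2 := h'.2 a h.1
  rw [hm] at h1 h2
  have h3 : ¬ (a ≤ m ∧ m ≤ b) := fun h => hmQ (hQ₀.out ha hb h)
  have h4 : ¬ (b ≤ m ∧ m ≤ a) := fun h => hmQ (hQ₀.out hb ha h)
  have h5 := abs_cases (a - m)
  have h6 := abs_cases (b - m)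
  omega

theorem seg_ordConnected {x : Cell} (hx : x ∈ S) : (seg S x).2.OrdConnected := by
  refine ⟨fun a ha b hb k hk => ?_⟩
  rw [mem_seg_iff hx] at ha hb ⊢
  have := mem_of_seg_eq ha.1 (ha.2.trans hb.2.symm) (k := k) (Or.inl hk)
  exact ⟨this.1, this.2.trans ha.2⟩

/-- Each segment has at most one nucleation site in a given adjacent segment. -/
theorem IsNucleationSite.unique (hS : HoleFree S) {F : Flank} {x x' y y' : Cell} (hx : x ∈ S)
    (hx' : x' ∈ S) (hy : y ∈ S) (hy' : y' ∈ S) (hxx : seg S x = seg S x')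
    (hyy : seg S y = seg S y') (hxy : hexGraph.Adj x y) (hxy' : hexGraph.Adj x' y')
    (hc : y.1 = x.1 + F.dir) (h : IsNucleationSite S x F) (h' : IsNucleationSite S x' F) :
    x = x' := by
  have hcx := column_eq_of_seg_eq hxx
  have hcy := column_eq_of_seg_eq hyy
  rcases h with h | h
  · exact eq_of_single_contact hx hy hxx hyy hxy hxy' hc h
  rcases h' with h' | h'
  · exact (eq_of_single_contact hx' hy' hxx.symm hyy.symm hxy' hxy (by omega) h').symm
  have h1 := midpoint_rule hS hy hxy hc h
  have h2 := midpoint_rule hS hy' hxy' (by omega) h'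
  rw [← hxx, ← hyy] at h2
  refine Prod.ext hcx (midpoint_rule_unique (seg_ordConnected hx) ?_ ?_ h1 h2)
  · exact (mem_seg_iff hx).2 ⟨hx, rfl⟩
  · rw [hxx]
    exact (mem_seg_iff hx').2 ⟨hx', rfl⟩

/-- `x` is the position from which the segment of `y` is nucleated, and `y` is next to it. -/
def IsSeed (S : Finset Cell) (x y : Cell) : Prop :=
  x ∈ S ∧ y ∈ S ∧ hexGraph.Adj x y ∧ depth S x < depth S y ∧
    ∃ F : Flank, IsNucleationSite S x F ∧ y.1 = x.1 + F.dir

/-- The parent is unique, so both seeds lie in one segment and use the same flank. -/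
theorem IsSeed.unique (hS : HoleFree S) {x x' y y' : Cell} (h : IsSeed S x y)
    (h' : IsSeed S x' y') (hj : Joined S y) (hyy : seg S y = seg S y') : x = x' := by
  obtain ⟨hx, hy, hxy, hd, F, hF, hc⟩ := h
  obtain ⟨hx', hy', hxy', hd', F', hF', hc'⟩ := h'
  have hxx := hS.seg_eq_of_depth_lt hy hy' hx hx' hj hyy hxy.symm hxy'.symm hd hd'
  have hcx := column_eq_of_seg_eq hxx
  have hcy := column_eq_of_seg_eq hyy
  have hFF : F = F' := by
    have : F.dir = F'.dir := by omega
    cases F <;> cases F' <;> simp_all [Flank.dir]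
  subst hFF
  exact IsNucleationSite.unique hS hx hx' hy hy' hxx hyy hxy hxy' hc hF hF'

/-! ### The invariant of executions -/

/-- The invariant: every segment is occupied contiguously, starting next to its nucleation site,
and an occupied position sees no free position in the segment from which its own segment was
nucleated. -/
structure Invariant (S : Finset Cell) (c : Config) : Prop where
  mem_shape : ∀ x ∈ c.occ, x ∈ S
  joined : ∀ x ∈ c.occ, Joined S x
  contiguous : ∀ x ∈ c.occ, ∀ y ∈ c.occ, seg S x = seg S y →
    ∀ k, x.2 ≤ k → k ≤ y.2 → (x.1, k) ∈ c.occ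
  lower_mem : ∀ z ∈ c.occ, ∀ v ∈ S, hexGraph.Adj z v → depth S v < depth S z → v ∈ c.occ
  seeded : ∀ z ∈ c.occ, depth S z ≠ 0 → ∃ x y, IsSeed S x y ∧ y ∈ c.occ ∧ seg S y = seg S z
  -- The growth direction points away from the parent; the delay rule therefore watches the parent's
  -- column.
  g_left : ∀ z ∈ c.occ, ∀ v ∈ S, hexGraph.Adj z v → depth S v < depth S z → v.1 = z.1 - 1 →
    (c.mem z).g = 1
  g_right : ∀ z ∈ c.occ, ∀ v ∈ S, hexGraph.Adj z v → depth S v < depth S z → v.1 = z.1 + 1 →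
    (c.mem z).g = -1
  flag_left : ∀ z ∈ c.occ, (c.mem z).αLeft = true → IsNucleationSite S z .left
  flag_right : ∀ z ∈ c.occ, (c.mem z).αRight = true → IsNucleationSite S z .right

/-- The properties of a position at which a robot may attach. -/
structure Attachable (S X : Finset Cell) (n : Cell) : Prop where
  mem_shape : n ∈ S
  joined : Joined S n
  lower_mem : ∀ v ∈ S, hexGraph.Adj n v → depth S v < depth S n → v ∈ X
  origin : (∃ m ∈ X, seg S m = seg S n ∧ (m.2 = n.2 + 1 ∨ m.2 = n.2 - 1)) ∨
    ∃ x ∈ X, IsSeed S x n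

/-- Growth along a column by `e = ±1`: if the delay rule is obeyed, the new position sees only
occupied positions of smaller depth. -/
theorem Invariant.lower_mem_of_growth (hS : HoleFree S) {c : Config} (hc : Invariant S c)
    {z n : Cell} {e : ℤ} (he : e = 1 ∨ e = -1) (hz : z ∈ c.occ) (hn : n ∈ S) (hnX : n ∉ c.occ)
    (hn1 : n.1 = z.1) (hn2 : n.2 = z.2 + e)
    (hdelay : ∀ t ∈ c.occ, ∀ v ∈ S, hexGraph.Adj z t → depth S t < depth S z →
      hexGraph.Adj n v → ¬ hexGraph.Adj z v → v.1 = t.1 → v.2 = t.2 + e → v ∈ c.occ) :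
    ∀ v ∈ S, hexGraph.Adj n v → depth S v < depth S n → v ∈ c.occ := by
  intro v hv hnv hd
  have hzS := hc.mem_shape z hz
  have hzj := hc.joined z hz
  have hzn : hexGraph.Adj z n := hexGraph_adj_iff.2 (by omega)
  have hseg : seg S z = seg S n := seg_eq_of_adj hzS hn hzn hn1.symm
  have hdz : depth S v < depth S z := by rwa [depth_congr hseg]
  by_cases hzv : hexGraph.Adj z v
  · exact hc.lower_mem z hz v hv hzv hdz
  have hcol : v.1 ≠ n.1 := fun h =>
    absurd (depth_congr (seg_eq_of_adj hn hv hnv h.symm)) hd.ne'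
  have hnv' := hexGraph_adj_iff.1 hnv
  have hzv' := mt hexGraph_adj_iff.2 hzv
  -- If the position one step behind `v` is in `S`, it is a parent position adjacent to `z`, hence
  -- occupied, and the delay rule applies to it.
  by_cases ht : (v.1, v.2 - e) ∈ S
  · have hst : seg S (v.1, v.2 - e) = seg S v :=
      seg_eq_of_adj ht hv (hexGraph_adj_iff.2 (Or.inl ⟨rfl, by simp only; omega⟩)) rfl
    have hdt : depth S (v.1, v.2 - e) < depth S z := by rwa [depth_congr hst]
    have hzt : hexGraph.Adj z (v.1, v.2 - e) := hexGraph_adj_iff.2 (by simp only; omega)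
    exact hdelay _ (hc.lower_mem z hz _ ht hzt hdt) v hv hzt hdt hnv hzv rfl (by simp only; omega)
  -- Otherwise the parent segment begins at `v` and extends in direction `e`. The seed lies in it,
  -- so the occupied stretch from `z` to the nucleated `y` already contains `n`.
  · exfalso
    obtain ⟨x, y, hxy, hy, hyz⟩ := hc.seeded z hz (by omega)
    have hyn := hyz.trans hseg
    have hvx : seg S v = seg S x := hS.seg_eq_of_depth_lt hn hxy.2.1 hv hxy.1
      (hzj.congr hseg) hyn.symm hnv hxy.2.2.1.symm hd hxy.2.2.2.1
    have hrow := row_lt_of_notMem hv hvx ht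
    have hcx := column_eq_of_seg_eq hvx
    have hcy := column_eq_of_seg_eq hyz
    have hadj := hexGraph_adj_iff.1 hxy.2.2.1
    apply hnX
    rw [show n = (z.1, n.2) from Prod.ext hn1 rfl]
    rcases he with rfl | rfl
    · exact hc.contiguous z hz y hy hyz.symm n.2 (by omega) (by omega)
    · rw [← hcy]
      exact hc.contiguous y hy z hz hyz n.2 (by omega) (by omega)

theorem Invariant.attachable (hS : HoleFree S) {c : Config} (hc : Invariant S c) {n : Cell}
    (hn : n ∉ c.occ) (h : Signaled (perimeter S) c n) : Attachable S c.occ n := by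
  obtain ⟨z, hz, w, ⟨⟨-, hfree, hw⟩, hnd⟩, rfl⟩ := h
  have hzS := hc.mem_shape z hz
  have hzj := hc.joined z hz
  have hnS : z + unitVec w ∈ S := ((status_eq_free_iff hS).1 hfree).1
  have hadj : hexGraph.Adj z (z + unitVec w) := ⟨w, rfl⟩
  have hnj := hzj.of_adj hzS hnS hadj
  by_cases hfa : status (perimeter S) c.occ z 0 = .free ∨ status (perimeter S) c.occ z 3 = .free
  · rw [if_pos hfa] at hw
    refine ⟨hnS, hnj, ?_, Or.inl ⟨z, hz, ?_⟩⟩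
    · rcases hw with rfl | rfl
      · refine hc.lower_mem_of_growth hS (Or.inl rfl) hz hnS hn (by simp [unitVec_zero])
          (by simp [unitVec_zero]) fun t ht v hv hzt hdt hnv hzv h1 h2 => ?_
        have hzt' := hexGraph_adj_iff.1 hzt
        have hnv' := hexGraph_adj_iff.1 hnv
        have hzv' := mt hexGraph_adj_iff.2 hzv
        have htS := hc.mem_shape t ht
        have htc : t.1 ≠ z.1 := fun h =>
          absurd (depth_congr (seg_eq_of_adj hzS htS hzt h.symm)) hdt.ne'
        simp only [unitVec_zero, Prod.fst_add, Prod.snd_add] at hnv'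
        -- If `v` is free, the neighbour `t` has a free wall `0` and delays wall `0` of `z`.
        by_contra hvX
        apply hnd
        rcases lt_or_gt_of_ne htc with hlt | hlt
        · have htz : t = z + unitVec 1 := by
            refine Prod.ext ?_ ?_ <;> simp only [unitVec_one, Prod.fst_add, Prod.snd_add] <;> omega
          have hvz : v = z + unitVec 1 + unitVec 0 := by
            rw [← htz]
            refine Prod.ext ?_ ?_ <;> simp only [unitVec_zero, Prod.fst_add, Prod.snd_add] <;> omega
          exact Or.inr ⟨hc.g_left z hz t htS hzt hdt (by omega), Or.inl ⟨rfl,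
            (status_eq_occupied_iff hS).2 (htz ▸ ⟨htS, ht⟩),
            (status_eq_free_iff hS).2 (hvz ▸ ⟨hv, hvX⟩)⟩⟩
        · have htz : t = z + unitVec 5 := by
            refine Prod.ext ?_ ?_ <;> simp only [unitVec_five, Prod.fst_add, Prod.snd_add] <;> omega
          have hvz : v = z + unitVec 5 + unitVec 0 := by
            rw [← htz]
            refine Prod.ext ?_ ?_ <;> simp only [unitVec_zero, Prod.fst_add, Prod.snd_add] <;> omega
          exact Or.inl ⟨hc.g_right z hz t htS hzt hdt (by omega), Or.inl ⟨rfl,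
            (status_eq_occupied_iff hS).2 (htz ▸ ⟨htS, ht⟩),
            (status_eq_free_iff hS).2 (hvz ▸ ⟨hv, hvX⟩)⟩⟩
      · refine hc.lower_mem_of_growth hS (Or.inr rfl) hz hnS hn (by simp [unitVec_three])
          (by simp [unitVec_three]) fun t ht v hv hzt hdt hnv hzv h1 h2 => ?_
        have hzt' := hexGraph_adj_iff.1 hzt
        have hnv' := hexGraph_adj_iff.1 hnv
        have hzv' := mt hexGraph_adj_iff.2 hzv
        have htS := hc.mem_shape t ht
        have htc : t.1 ≠ z.1 := fun h =>
          absurd (depth_congr (seg_eq_of_adj hzS htS hzt h.symm)) hdt.ne'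
        simp only [unitVec_three, Prod.fst_add, Prod.snd_add] at hnv'
        by_contra hvX
        apply hnd
        rcases lt_or_gt_of_ne htc with hlt | hlt
        · have htz : t = z + unitVec 2 := by
            refine Prod.ext ?_ ?_ <;> simp only [unitVec_two, Prod.fst_add, Prod.snd_add] <;> omega
          have hvz : v = z + unitVec 2 + unitVec 3 := by
            rw [← htz]
            refine Prod.ext ?_ ?_ <;> simp only [unitVec_three, Prod.fst_add, Prod.snd_add] <;> omega
          exact Or.inr ⟨hc.g_left z hz t htS hzt hdt (by omega), Or.inr ⟨rfl,
            (status_eq_occupied_iff hS).2 (htz ▸ ⟨htS, ht⟩),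
            (status_eq_free_iff hS).2 (hvz ▸ ⟨hv, hvX⟩)⟩⟩
        · have htz : t = z + unitVec 4 := by
            refine Prod.ext ?_ ?_ <;> simp only [unitVec_four, Prod.fst_add, Prod.snd_add] <;> omega
          have hvz : v = z + unitVec 4 + unitVec 3 := by
            rw [← htz]
            refine Prod.ext ?_ ?_ <;> simp only [unitVec_three, Prod.fst_add, Prod.snd_add] <;> omega
          exact Or.inl ⟨hc.g_right z hz t htS hzt hdt (by omega), Or.inr ⟨rfl,
            (status_eq_occupied_iff hS).2 (htz ▸ ⟨htS, ht⟩),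
            (status_eq_free_iff hS).2 (hvz ▸ ⟨hv, hvX⟩)⟩⟩
    · rcases hw with rfl | rfl
      · exact ⟨seg_eq_of_adj hzS hnS hadj (by simp [unitVec_zero]), by simp [unitVec_zero]⟩
      · exact ⟨seg_eq_of_adj hzS hnS hadj (by simp [unitVec_three]), by simp [unitVec_three]⟩
  · rw [if_neg hfa] at hw
    obtain ⟨hw, hwhy⟩ := hw
    have hadj' := hexGraph_adj_iff.1 hadj
    have hcol : z.1 ≠ (z + unitVec w).1 := by
      rcases hw with rfl | rfl | rfl | rfl <;>
        simp [unitVec_one, unitVec_two, unitVec_four, unitVec_five]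
    have hd : depth S z < depth S (z + unitVec w) := by
      refine lt_of_le_of_ne (not_lt.1 fun h => hn (hc.lower_mem z hz _ hnS hadj h)) ?_
      exact depth_ne_of_adj hzj hzS hnS hadj hcol
    have hfa0 : z + unitVec 0 ∈ S → z + unitVec 0 ∈ c.occ := fun h => by
      by_contra h'
      exact hfa (Or.inl ((status_eq_free_iff hS).2 ⟨h, h'⟩))
    have hfa3 : z + unitVec 3 ∈ S → z + unitVec 3 ∈ c.occ := fun h => by
      by_contra h'
      exact hfa (Or.inr ((status_eq_free_iff hS).2 ⟨h, h'⟩))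
    refine ⟨hnS, hnj, fun v hv hnv hdv => ?_, ?_⟩
    -- Lower neighbours of the new position lie in the segment of its parent `z`, at most one row
    -- from `z`; fore-aft walls of `z` are not free, so they are occupied.
    · have hvz := column_eq_of_seg_eq (hS.seg_eq_of_depth_lt hnS hnS hv hzS hnj rfl hnv hadj.symm
        hdv hd)
      have hnv' := hexGraph_adj_iff.1 hnv
      have : v.2 = z.2 ∨ v.2 = z.2 + 1 ∨ v.2 = z.2 + -1 := by omega
      rcases this with h | h | h
      · rwa [Prod.ext hvz h]
      · have hv0 : v = z + unitVec 0 := Prod.ext (by simp [unitVec_zero, hvz]) h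
        rw [hv0] at hv ⊢
        exact hfa0 hv
      · have hv3 : v = z + unitVec 3 := Prod.ext (by simp [unitVec_three, hvz]) h
        rw [hv3] at hv ⊢
        exact hfa3 hv
    · rcases hwhy with hsp | ⟨hα, hwF⟩ | ⟨hα, hwF⟩
      · left
        -- Every alternative of `SpecialCondition` makes the other wall of the same flank occupied.
        have hm : ∃ w', status (perimeter S) c.occ z w' = .occupied ∧
            (z + unitVec w').1 = (z + unitVec w).1 ∧
            ((z + unitVec w').2 = (z + unitVec w).2 + 1 ∨
              (z + unitVec w').2 = (z + unitVec w).2 - 1) := by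
          unfold SpecialCondition at hsp
          rcases hw with rfl | rfl | rfl | rfl
          · exact ⟨2, by simp at hsp; tauto, by simp [unitVec_one, unitVec_two]⟩
          · exact ⟨1, by simp at hsp; tauto, by simp [unitVec_one, unitVec_two]⟩
          · exact ⟨5, by simp at hsp; tauto, by simp [unitVec_four, unitVec_five]⟩
          · exact ⟨4, by simp at hsp; tauto, by simp [unitVec_four, unitVec_five]; omega⟩
        obtain ⟨w', hocc, h1, h2⟩ := hm
        obtain ⟨hmS, hmX⟩ := (status_eq_occupied_iff hS).1 hocc
        exact ⟨_, hmX, seg_eq_of_adj hmS hnS (hexGraph_adj_iff.2 (by omega)) h1, h2⟩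
      · refine Or.inr ⟨z, hz, hzS, hnS, hadj, hd, .left, hc.flag_left z hz hα, ?_⟩
        rcases Flank.mem_left.1 hwF with rfl | rfl <;>
          simp [unitVec_one, unitVec_two, Flank.dir]
      · refine Or.inr ⟨z, hz, hzS, hnS, hadj, hd, .right, hc.flag_right z hz hα, ?_⟩
        rcases Flank.mem_right.1 hwF with rfl | rfl <;>
          simp [unitVec_four, unitVec_five, Flank.dir]

/-! ### Preservation of the invariant -/

/-- A robot that attaches next to a position of smaller depth grows away from it: no wall on that
side is free, and no wall on the other side is occupied. -/
theorem Attachable.initialMemory_g (hS : HoleFree S) {X X' : Finset Cell} {n v : Cell}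
    (hn : Attachable S X n) (hX : ∀ x ∈ X, x ∈ X')
    (hX' : ∀ x ∈ X', x ∈ S → hexGraph.Adj n x → ¬ depth S n < depth S x)
    (hv : v ∈ S) (hnv : hexGraph.Adj n v) (hd : depth S v < depth S n) :
    (v.1 = n.1 - 1 → (initialMemory (perimeter S) X' n).g = 1) ∧
      (v.1 = n.1 + 1 → (initialMemory (perimeter S) X' n).g = -1) := by
  have hnS := hn.mem_shape
  have hvX := hX v (hn.lower_mem v hv hnv hd)
  have hside : ∀ w, (n + unitVec w).1 = v.1 →
      status (perimeter S) X' n w ≠ .free := by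
    intro w hw hfree
    obtain ⟨h1, h2⟩ := (status_eq_free_iff hS).1 hfree
    have hadj : hexGraph.Adj n (n + unitVec w) := ⟨w, rfl⟩
    have hcol : v.1 ≠ n.1 := fun h =>
      absurd (depth_congr (seg_eq_of_adj hnS hv hnv h.symm)) hd.ne'
    have hseg : seg S v = seg S (n + unitVec w) := by
      refine (seg_eq_iff hv).2 ⟨hw.symm, fun k hk => ?_⟩
      have hadj' := hexGraph_adj_iff.1 hadj
      have hnv' := hexGraph_adj_iff.1 hnv
      rw [Set.mem_uIcc] at hk
      have : k = v.2 ∨ k = (n + unitVec w).2 := by omega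
      rcases this with rfl | rfl
      · exact hv
      · rw [← hw]
        exact h1
    exact h2 (hX _ (hn.lower_mem _ h1 hadj (by rwa [← depth_congr hseg])))
  have hother : ∀ w, (n + unitVec w).1 ≠ v.1 → (n + unitVec w).1 ≠ n.1 →
      status (perimeter S) X' n w ≠ .occupied := by
    intro w hw hw' hocc
    obtain ⟨h1, h2⟩ := (status_eq_occupied_iff hS).1 hocc
    have hadj : hexGraph.Adj n (n + unitVec w) := ⟨w, rfl⟩
    rcases lt_or_gt_of_ne (depth_ne_of_adj hn.joined hnS h1 hadj hw'.symm) with h | h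
    · exact hX' _ h2 h1 hadj h
    · exact hw (column_eq_of_seg_eq (hS.seg_eq_of_depth_lt hnS hnS h1 hv hn.joined rfl hadj hnv
        h hd))
  obtain ⟨u, rfl⟩ := hnv
  have hu : status (perimeter S) X' n u = .occupied := (status_eq_occupied_iff hS).2 ⟨hv, hvX⟩
  constructor
  · intro hcol
    have hα : nucleation (perimeter S) (status (perimeter S) X' n) n .left = false := by
      refine nucleation_eq_false fun w hw => hside w ?_
      rw [hcol]
      rcases Flank.mem_left.1 hw with rfl | rfl <;> simp [unitVec_one, unitVec_two] <;> ring
    have hu12 : u = 1 ∨ u = 2 := by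
      revert hcol
      fin_cases u <;> simp [unitVec]
      all_goals omega
    simp only [initialMemory, growthDirection, hα]
    rcases hu12 with rfl | rfl <;> simp [hu]
  · intro hcol
    have hα : nucleation (perimeter S) (status (perimeter S) X' n) n .right = false := by
      refine nucleation_eq_false fun w hw => hside w ?_
      rw [hcol]
      rcases Flank.mem_right.1 hw with rfl | rfl <;> simp [unitVec_four, unitVec_five]
    have hu45 : u = 4 ∨ u = 5 := by
      revert hcol
      fin_cases u <;> simp [unitVec]
    -- `growthDirection` tests the left flank first, so here occupied left walls must be excluded as
    -- well.
    have h1 := hother 1 (by rw [hcol]; simp [unitVec_one]) (by simp [unitVec_one])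
    have h2 := hother 2 (by rw [hcol]; simp [unitVec_two]) (by simp [unitVec_two])
    simp only [initialMemory, growthDirection, hα, h1, h2]
    rcases hu45 with rfl | rfl <;> simp [hu]

theorem initialMemory_flag (hS : HoleFree S) (X : Finset Cell) (n : Cell) :
    ((initialMemory (perimeter S) X n).αLeft = true → IsNucleationSite S n .left) ∧
      ((initialMemory (perimeter S) X n).αRight = true → IsNucleationSite S n .right) :=
  ⟨isNucleationSite_of_nucleation hS, isNucleationSite_of_nucleation hS⟩

/-- Positions started from the same seed on one flank leave no gap. -/
theorem row_close_of_adj {x y z : Cell} (hy : hexGraph.Adj x y) (hz : hexGraph.Adj x z)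
    (hc : y.1 = z.1) (hx : x.1 ≠ y.1) : y.2 ≤ z.2 + 1 ∧ z.2 ≤ y.2 + 1 := by
  rw [hexGraph_adj_iff] at hy hz
  omega

theorem IsSeed.column_ne {x y : Cell} (h : IsSeed S x y) : x.1 ≠ y.1 := by
  obtain ⟨-, -, -, -, F, -, hc⟩ := h
  cases F <;> simp only [Flank.dir] at hc <;> omega

/-- Segments that are occupied contiguously remain so. -/
theorem Invariant.contiguous_union (hS : HoleFree S) {c : Config} (hc : Invariant S c)
    {N : Finset Cell} (hN : ∀ n ∈ N, Attachable S c.occ n) :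
    ∀ x ∈ c.occ ∪ N, ∀ y ∈ c.occ ∪ N, seg S x = seg S y →
      ∀ k, x.2 ≤ k → k ≤ y.2 → (x.1, k) ∈ c.occ ∪ N := by
  intro x hx y hy hxy k hk1 hk2
  have hcol := column_eq_of_seg_eq hxy
  by_cases hm : ∃ m ∈ c.occ, seg S m = seg S x
  · obtain ⟨m, hm, hmx⟩ := hm
    -- In a segment begun earlier, a new position is next to an old one or shares its seed with one.
    -- Rows strictly between two positions thus lie between old ones.
    have hnear : ∀ z ∈ c.occ ∪ N, seg S z = seg S x →
        ∃ z' ∈ c.occ, seg S z' = seg S x ∧ z.2 ≤ z'.2 + 1 ∧ z'.2 ≤ z.2 + 1 := by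
      intro z hz hzx
      rcases Finset.mem_union.1 hz with hz | hz
      · exact ⟨z, hz, hzx, by omega, by omega⟩
      rcases (hN z hz).origin with ⟨z', hz', hs, hrow⟩ | ⟨s, hs, hsz⟩
      · exact ⟨z', hz', hs.trans hzx, by omega, by omega⟩
      · have hmz := hmx.trans hzx.symm
        have hdm : depth S m ≠ 0 := by
          rw [depth_congr hmz]
          exact (Nat.zero_lt_of_lt hsz.2.2.2.1).ne'
        obtain ⟨s', y', hsy', hy', hym⟩ := hc.seeded m hm hdm
        have hzy : seg S z = seg S y' := (hym.trans hmz).symm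
        have hss := hsz.unique hS hsy' (hN z hz).joined hzy
        subst hss
        exact ⟨y', hy', hym.trans hmx, row_close_of_adj hsz.2.2.1 hsy'.2.2.1
          (column_eq_of_seg_eq hzy) hsz.column_ne⟩
    by_cases hkx : k = x.2
    · rw [hkx]
      exact hx
    by_cases hky : k = y.2
    · rw [hky, hcol]
      exact hy
    obtain ⟨x', hx', hxs, hx1, hx2⟩ := hnear x hx rfl
    obtain ⟨y', hy', hys, hy1, hy2⟩ := hnear y hy hxy.symm
    refine Finset.mem_union_left _ ?_
    rw [← column_eq_of_seg_eq hxs]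
    exact hc.contiguous x' hx' y' hy' (hxs.trans hys.symm) k (by omega) (by omega)
  -- In a segment begun in this step, all positions are adjacent to the one seed.
  · have hnew : ∀ z ∈ c.occ ∪ N, seg S z = seg S x → ∃ s, IsSeed S s z ∧ Joined S z := by
      intro z hz hzx
      rcases Finset.mem_union.1 hz with hz | hz
      · exact absurd ⟨z, hz, hzx⟩ hm
      rcases (hN z hz).origin with ⟨z', hz', hs, -⟩ | ⟨s, -, hsz⟩
      · exact absurd ⟨z', hz', hs.trans hzx⟩ hm
      · exact ⟨s, hsz, (hN z hz).joined⟩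
    obtain ⟨s, hsx, hj⟩ := hnew x hx rfl
    obtain ⟨s', hsy, -⟩ := hnew y hy hxy.symm
    have hss := hsx.unique hS hsy hj hxy
    subst hss
    have := row_close_of_adj hsx.2.2.1 hsy.2.2.1 hcol hsx.column_ne
    have hk : k = x.2 ∨ k = y.2 := by omega
    rcases hk with rfl | rfl
    · exact hx
    · rw [hcol]
      exact hy

theorem Invariant.step (hS : HoleFree S) {c c' : Config} (hc : Invariant S c)
    (h : Step (perimeter S) c c') : Invariant S c' := by
  obtain ⟨N, hN, hocc, hold, hnew⟩ := h
  have hat : ∀ n ∈ N, Attachable S c.occ n := fun n hn =>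
    hc.attachable hS (hN n hn).1 (hN n hn).2
  have hcase : ∀ {z}, z ∈ c'.occ → z ∈ c.occ ∨ z ∈ N := fun {z} hz => by
    rwa [hocc, Finset.mem_union] at hz
  have hsub : ∀ z ∈ c.occ, z ∈ c'.occ := fun z hz => by
    rw [hocc]
    exact Finset.mem_union_left _ hz
  have hsubN : ∀ z ∈ N, z ∈ c'.occ := fun z hz => by
    rw [hocc]
    exact Finset.mem_union_right _ hz
  -- This covers neighbours attached in the same step: their lower neighbours were occupied before
  -- it, whereas `n` was not.
  have hhigher : ∀ n ∈ N, ∀ x ∈ c'.occ, x ∈ S → hexGraph.Adj n x → ¬ depth S n < depth S x := by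
    intro n hn x hx hxS hnx hd
    apply (hN n hn).1
    rcases hcase hx with hx | hx
    · exact hc.lower_mem x hx n (hat n hn).mem_shape hnx.symm hd
    · exact (hat x hx).lower_mem n (hat n hn).mem_shape hnx.symm hd
  refine ⟨?_, ?_, ?_, ?_, ?_, ?_, ?_, ?_, ?_⟩
  · exact fun x hx => (hcase hx).elim (hc.mem_shape x) fun h => (hat x h).mem_shape
  · exact fun x hx => (hcase hx).elim (hc.joined x) fun h => (hat x h).joined
  · rw [hocc]
    exact hc.contiguous_union hS hat
  · exact fun z hz v hv hzv hd => hsub v ((hcase hz).elim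
      (fun h => hc.lower_mem z h v hv hzv hd) fun h => (hat z h).lower_mem v hv hzv hd)
  · intro z hz hd
    have hold' : ∀ m ∈ c.occ, seg S m = seg S z →
        ∃ x y, IsSeed S x y ∧ y ∈ c'.occ ∧ seg S y = seg S z := by
      intro m hm hmz
      obtain ⟨x, y, h1, h2, h3⟩ := hc.seeded m hm (by rwa [depth_congr hmz])
      exact ⟨x, y, h1, hsub y h2, h3.trans hmz⟩
    rcases hcase hz with hzX | hzN
    · exact hold' z hzX rfl
    rcases (hat z hzN).origin with ⟨m, hm, hmz, -⟩ | ⟨x, -, hxz⟩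
    · exact hold' m hm hmz
    · exact ⟨x, z, hxz, hz, rfl⟩
  · intro z hz v hv hzv hd hcol
    rcases hcase hz with hz | hz
    · rw [hold z hz]
      exact hc.g_left z hz v hv hzv hd hcol
    · rw [hnew z hz]
      exact ((hat z hz).initialMemory_g hS hsub (hhigher z hz) hv hzv hd).1 hcol
  · intro z hz v hv hzv hd hcol
    rcases hcase hz with hz | hz
    · rw [hold z hz]
      exact hc.g_right z hz v hv hzv hd hcol
    · rw [hnew z hz]
      exact ((hat z hz).initialMemory_g hS hsub (hhigher z hz) hv hzv hd).2 hcol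
  · intro z hz
    rcases hcase hz with hz | hz
    · rw [hold z hz]
      exact hc.flag_left z hz
    · rw [hnew z hz]
      exact (initialMemory_flag hS _ z).1
  · intro z hz
    rcases hcase hz with hz | hz
    · rw [hold z hz]
      exact hc.flag_right z hz
    · rw [hnew z hz]
      exact (initialMemory_flag hS _ z).2

theorem depth_root : depth S (0, 0) = 0 := SimpleGraph.dist_self

theorem invariant_of_isExecution (hS : HoleFree S) (hroot : ((0, 0) : Cell) ∈ S)
    {run : ℕ → Config} (hrun : IsExecution (perimeter S) run) (t : ℕ) : Invariant S (run t) := by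
  induction t with
  | zero =>
    obtain ⟨hocc, hmem, -⟩ := hrun
    refine ⟨?_, ?_, ?_, ?_, ?_, ?_, ?_, ?_, ?_⟩ <;> intro x hx <;>
      rw [hocc, Finset.mem_singleton] at hx <;> subst hx
    · exact hroot
    · exact SimpleGraph.Reachable.refl _
    · intro y hy _ k hk1 hk2
      rw [hocc, Finset.mem_singleton] at hy ⊢
      subst hy
      exact Prod.ext rfl (le_antisymm hk2 hk1)
    · intro v _ _ hd
      rw [depth_root] at hd
      exact absurd hd (Nat.not_lt_zero _)
    · exact fun h => absurd depth_root h
    · intro v _ _ hd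
      rw [depth_root] at hd
      exact absurd hd (Nat.not_lt_zero _)
    · intro v _ _ hd
      rw [depth_root] at hd
      exact absurd hd (Nat.not_lt_zero _)
    · rw [hmem]
      exact (initialMemory_flag hS _ _).1
    · rw [hmem]
      exact (initialMemory_flag hS _ _).2
  | succ t ih => exact ih.step hS (hrun.2.2 t)

/-! ### Degrees -/

theorem degreeIfAdded_pos {X : Finset Cell} {x y : Cell} (hx : x ∈ X) (h : hexGraph.Adj y x) :
    1 ≤ degreeIfAdded X y := by
  rw [degreeIfAdded, Nat.one_le_iff_ne_zero, ← Nat.pos_iff_ne_zero,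
    SimpleGraph.degree_pos_iff_exists_adj]
  exact ⟨⟨x, Finset.mem_insert_of_mem hx⟩, h⟩

theorem degreeIfAdded_le_card (X : Finset Cell) (y : Cell) :
    degreeIfAdded X y ≤ (Finset.univ.filter fun w : Wall => y + unitVec w ∈ X).card := by
  rw [degreeIfAdded, ← SimpleGraph.card_neighborFinset_eq_degree,
    ← Finset.card_image_of_injective _ Subtype.val_injective]
  refine (Finset.card_le_card ?_).trans
    (Finset.card_image_le (f := fun w : Wall => y + unitVec w))
  intro v hv
  obtain ⟨⟨v, hvX⟩, hadj, rfl⟩ := Finset.mem_image.1 hv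
  rw [SimpleGraph.mem_neighborFinset] at hadj
  obtain ⟨w, hw⟩ : hexGraph.Adj y v := hadj
  refine Finset.mem_image.2 ⟨w, Finset.mem_filter.2 ⟨Finset.mem_univ _, ?_⟩, hw.symm⟩
  rw [← hw]
  refine (Finset.mem_insert.1 hvX).resolve_left ?_
  rintro rfl
  exact unitVec_ne_zero w (by simpa using hw)

/-- At most one fore-aft wall and the two walls of one flank remain. -/
theorem card_walls_le_three : ∀ W : Finset Wall, ¬ (0 ∈ W ∧ 3 ∈ W) →
    ¬ ((1 ∈ W ∨ 2 ∈ W) ∧ (4 ∈ W ∨ 5 ∈ W)) → W.card ≤ 3 := by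
  decide

theorem Invariant.maintainsReachability (hS : HoleFree S) {c : Config} (hc : Invariant S c) :
    MaintainsReachability S c.occ := by
  rintro y ⟨hyS, hyX, x, hx, hyx⟩
  refine ⟨degreeIfAdded_pos hx hyx, (degreeIfAdded_le_card _ y).trans
    (card_walls_le_three _ ?_ ?_)⟩
  · simp only [Finset.mem_filter, Finset.mem_univ, true_and]
    rintro ⟨h0, h3⟩
    have hs0 := seg_eq_of_adj hyS (hc.mem_shape _ h0) ⟨0, rfl⟩ (by simp [unitVec_zero])
    have hs3 := seg_eq_of_adj hyS (hc.mem_shape _ h3) ⟨3, rfl⟩ (by simp [unitVec_three])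
    have := hc.contiguous _ h3 _ h0 (hs3.symm.trans hs0) y.2 (by simp [unitVec_three])
      (by simp [unitVec_zero])
    apply hyX
    simpa [unitVec_three] using this
  · simp only [Finset.mem_filter, Finset.mem_univ, true_and]
    have hyj : Joined S y := (hc.joined x hx).of_adj (hc.mem_shape x hx) hyS hyx.symm
    -- An occupied neighbour of greater depth would force its lower neighbour `y` to be occupied.
    have hlow : ∀ w, y + unitVec w ∈ c.occ → (y + unitVec w).1 ≠ y.1 →
        depth S (y + unitVec w) < depth S y := by
      intro w hw hne
      have hadj : hexGraph.Adj y (y + unitVec w) := ⟨w, rfl⟩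
      have hwS := hc.mem_shape _ hw
      refine lt_of_le_of_ne (not_lt.1 fun h => hyX ?_)
        (depth_ne_of_adj hyj hyS hwS hadj hne.symm).symm
      exact hc.lower_mem _ hw y hyS hadj.symm h
    have hcol : ∀ w w', y + unitVec w ∈ c.occ → y + unitVec w' ∈ c.occ →
        (y + unitVec w).1 ≠ y.1 → (y + unitVec w').1 ≠ y.1 →
        (y + unitVec w).1 = (y + unitVec w').1 := fun w w' hw hw' hne hne' =>
      column_eq_of_seg_eq (hS.seg_eq_of_depth_lt hyS hyS (hc.mem_shape _ hw) (hc.mem_shape _ hw')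
        hyj rfl ⟨w, rfl⟩ ⟨w', rfl⟩ (hlow w hw hne) (hlow w' hw' hne'))
    rintro ⟨hl | hl, hr | hr⟩ <;>
    · have := hcol _ _ hl hr (by simp [unitVec]) (by simp [unitVec])
      simp [unitVec] at this

end Huddle

end

theorem theorem1 (S : Finset Huddle.Cell) (hS : Huddle.HoleFree S)
    (hroot : ((0, 0) : Huddle.Cell) ∈ S)
    (run : ℕ → Huddle.Config)
    (hrun : Huddle.IsExecution (Huddle.perimeter S) run) (t : ℕ) :
    Huddle.MaintainsReachability S (run t).occ :=
  (Huddle.invariant_of_isExecution hS hroot hrun t).maintainsReachability hS
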